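/- A dyadic interval is an interval $I=[m2^{-k},(m+1)2^{-k})\subset\mathbb R$ with $k,m\in\mathbb Z$; its $L^2$-normalized Haar function is $h_I=|I|^{-1/2}(1_{I_{\rm left}}-1_{I_{\rm right}})$, where $I_{\rm left},I_{\rm right}$ are the two halves of $I$. For $i\in\mathbb Z$ put $$\Delta_i f=\sum_{|I|=2^{1-i}}\langle f,h_I\rangle h_I .$$ For $1<p<\infty$, a measurable function $w$ on $\mathbb R$ that is positive almost everywhere belongs to (dyadic) $A_p$ if $$[w]_{A_p}=\sup_{I\text{ dyadic}}\Bigl(\frac1{|I|}\int_I w\,dx\Bigr)\Bigl(\frac1{|I|}\int_I w^{-1/(p-1)}\,dx\Bigr)^{p-1}<\infty .$$ Write $\|f\|_{L^p(w)}=(\int_{\mathbb R}|f|^p\,w\,dx)^{1/p}$. **Lemma (weighted Lépingle inequality).** Let $1<p<\infty$ and let $w\in A_p$. (1) For every $2<r<\infty$ there is a constant $C<\infty$, depending only on $p$, $w$ and $r$, such that for every measurable $f:\mathbb R\to\mathbb C$ $$\Bigl\|\sup_{M,\,N_0<N_1<\dots<N_M}\Bigl(\sum_{k=1}^M\Bigl|\sum_{N_{k-1}<j\le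 N_k}\Delta_jf\Bigr|^r\Bigr)^{1/r}\Bigr\|_{L^p(w)}\le C\,\|f\|_{L^p(w)} .$$ (2) There is a constant $C<\infty$, depending only on $p$ and $w$, such that for every measurable $f:\mathbb R\to\mathbb C$ and every $\lambda>0$ $$\|\lambda\,M_\lambda^{1/2}\|_{L^p(w)}\le C\,\|f\|_{L^p(w)},\qquad M_\lambda(x)=\sup_{M,\,N_0<N_1<\dots<N_M}\#\Bigl\{1\le k\le M:\Bigl|\sum_{N_{k-1}<j\le N_k}\Delta_jf(x)\Bigr|>\lambda\Bigr\}.$$ In both parts the suprema are over all natural numbers $M$ and all integers $N_0<N_1<\dots<N_M$. (If $\|f\|_{L^p(w)}<\infty$, then $f$ is integrable on every dyadic interval, so the coefficients $\langle f,h_I\rangle$ are defined; if $\|f\|_{L^p(w)}=\infty$, the inequalities are understood to hold trivially.) -/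

import Mathlib

open MeasureTheory
open scoped ENNReal NNReal

noncomputable section

/-- The dyadic interval `[m 2⁻ᵏ, (m+1) 2⁻ᵏ)` of length `2⁻ᵏ`, for integers `k` and `m`. -/
def dyadicIco (k m : ℤ) : Set ℝ :=
  Set.Ico ((m : ℝ) * (2 : ℝ) ^ (-k)) (((m : ℝ) + 1) * (2 : ℝ) ^ (-k))

/-- The `L²`-normalized Haar function `h_I = |I|^{-1/2} (1_{I_left} - 1_{I_right})` of the
dyadic interval `I = dyadicIco k m`, whose two halves are `dyadicIco (k+1) (2m)` and
`dyadicIco (k+1) (2m+1)`. -/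
def dyadicHaar (k m : ℤ) (x : ℝ) : ℝ :=
  Real.sqrt ((2 : ℝ) ^ k) *
    ((dyadicIco (k + 1) (2 * m)).indicator (fun _ => (1 : ℝ)) x -
      (dyadicIco (k + 1) (2 * m + 1)).indicator (fun _ => (1 : ℝ)) x)

/-- The Haar coefficient `⟨f, h_I⟩` for `I = dyadicIco k m`. -/
def dyadicHaarCoeff (f : ℝ → ℂ) (k m : ℤ) : ℂ :=
  ∫ x, f x * (dyadicHaar k m x : ℂ)

/-- `Δ_i f = ∑_{|I| = 2^{1-i}} ⟨f, h_I⟩ h_I`. At each point at most one term is nonzero. -/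
def dyadicDelta (i : ℤ) (f : ℝ → ℂ) (x : ℝ) : ℂ :=
  ∑' m : ℤ, dyadicHaarCoeff f (i - 1) m * (dyadicHaar (i - 1) m x : ℂ)

/-- The increment `∑_{a < j ≤ b} Δ_j f` of the dyadic martingale. -/
def dyadicIncrement (f : ℝ → ℂ) (a b : ℤ) (x : ℝ) : ℂ :=
  ∑ j ∈ Finset.Ioc a b, dyadicDelta j f x

/-- The `r`-variation
`sup_{M, N_0 < ... < N_M} (∑_{k=1}^M |∑_{N_{k-1} < j ≤ N_k} Δ_j f(x)|^r)^{1/r}`. -/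
def dyadicVariation (r : ℝ) (f : ℝ → ℂ) (x : ℝ) : ℝ≥0∞ :=
  ⨆ (M : ℕ) (N : Fin (M + 1) → ℤ) (_ : StrictMono N),
    (∑ k : Fin M, ‖dyadicIncrement f (N k.castSucc) (N k.succ) x‖ₑ ^ r) ^ (1 / r)

/-- The jump counting function
`M_lam(x) = sup_{M, N_0 < ... < N_M} #{k : |∑_{N_{k-1} < j ≤ N_k} Δ_j f(x)| > lam}`. -/
def dyadicJumpCount (lam : ℝ) (f : ℝ → ℂ) (x : ℝ) : ℝ≥0∞ :=
  ⨆ (M : ℕ) (N : Fin (M + 1) → ℤ) (_ : StrictMono N),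
    ((Finset.univ.filter fun k : Fin M =>
      lam < ‖dyadicIncrement f (N k.castSucc) (N k.succ) x‖).card : ℝ≥0∞)

/-- The dyadic `A_p` characteristic
`[w]_{A_p} = sup_I (|I|⁻¹ ∫_I w) (|I|⁻¹ ∫_I w^{-1/(p-1)})^{p-1}`, `I` over all dyadic intervals. -/
def dyadicApConst (p : ℝ) (w : ℝ → ℝ) : ℝ≥0∞ :=
  ⨆ (k : ℤ) (m : ℤ),
    (⨍⁻ x in dyadicIco k m, ENNReal.ofReal (w x) ∂volume) *
      (⨍⁻ x in dyadicIco k m, ENNReal.ofReal (w x) ^ (-(1 / (p - 1))) ∂volume) ^ (p - 1)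

/-- `w` is an `A_p` weight: measurable, positive almost everywhere, and `[w]_{A_p} < ∞`. -/
def IsDyadicAp (p : ℝ) (w : ℝ → ℝ) : Prop :=
  AEMeasurable w ∧ (∀ᵐ x, 0 < w x) ∧ dyadicApConst p w < ∞

/-- The measure `w(x) dx`. -/
def weightMeasure (w : ℝ → ℝ) : Measure ℝ :=
  (volume : Measure ℝ).withDensity fun x => ENNReal.ofReal (w x)

end

/-! Write `E_k f` for the average of `f` over the dyadic interval of length `2⁻ᵏ` around a point.
Then `Δ_j f = E_j f - E_{j-1} f`, so both quantities measure the oscillation of the martingale path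
`a_k = E_k f(x)`. Finite stretches of the path are treated with constants independent of their
length, and Fatou's lemma gives the general case.

Jumps are counted greedily: a time is chosen when the path has moved by more than `λ` from its value
`b_k` at the last chosen time. The quantity `|a_{k+1} - b_k|² - |a_{k+1} - b_{k+1}|²` is at least
`λ²` at a chosen time and `0` otherwise. It equals `-2 Re (conj b_k (a_{k+1} - a_k))`, which has
mean zero, plus the increment of `|a_k|² - |a_k - b_k|²`, which telescopes
(`sq_mul_greedyCount_sub_le`). Let `I` be a dyadic interval on which the averages of `|f|` have so
far been at most `b`. Stopping once an average exceeds `4b` keeps the path below `8b`, so the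
integral over `I` of the number of jumps before stopping is `O(b²/λ²) |I|`; by the weak type
inequality stopping occurs on at most a quarter of `I`. For `r > 2`, summing over `λ = 4b 2⁻¹, 4b
2⁻², …` gives a convergent geometric series for the `r`-variation. Hence, for `X = λ N^{1/2}` with
`N` the greedy count, and for `X` the variation, `X` grows by more than a constant times `b` beyond
`I` on at most half of `I`.

The weight then enters in two places. By Hölder and the `A_p` condition, half of `I` carries at most
a proportion `θ < 1` of `w(I)`, so a good-`λ` inequality `w{X > t + Cb} ≤ w{M|f| > b} + θ w{X > t}`
holds. Although `θ` is not small, taking `b` to be a small multiple of `t` lets the last term be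
absorbed, and `X` is bounded by `M|f|` in `L^p(w)`. Muckenhoupt's theorem for `M` follows by
applying Doob's inequality once for `w dx` and once for the dual weight. -/

/-! ### Dyadic intervals and adapted functions. -/

/-- The index `m` of the dyadic interval `dyadicIco k m` that contains `x`. -/
noncomputable def dyadicIndex (k : ℤ) (x : ℝ) : ℤ := ⌊x * (2 : ℝ) ^ k⌋

/-- The dyadic interval of length `2⁻ᵏ` that contains `x`. -/
noncomputable def dyadicCell (k : ℤ) (x : ℝ) : Set ℝ := dyadicIco k (dyadicIndex k x)

/-- A function is adapted to generation `k` if it is constant on dyadic intervals of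
length `2⁻ᵏ`. -/
def DyadicAdapted {β : Type*} (k : ℤ) (h : ℝ → β) : Prop :=
  ∀ x y, dyadicIndex k x = dyadicIndex k y → h x = h y

theorem mem_dyadicIco_iff {k m : ℤ} {x : ℝ} : x ∈ dyadicIco k m ↔ dyadicIndex k x = m := by
  have h2 : (0 : ℝ) < 2 ^ k := by positivity
  rw [dyadicIco, dyadicIndex, Int.floor_eq_iff, Set.mem_Ico, zpow_neg, ← div_eq_mul_inv,
    ← div_eq_mul_inv, div_le_iff₀ h2, lt_div_iff₀ h2]

theorem mem_dyadicCell_iff {k : ℤ} {x y : ℝ} :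
    y ∈ dyadicCell k x ↔ dyadicIndex k y = dyadicIndex k x := mem_dyadicIco_iff

theorem dyadicCell_eq_of_mem {k m : ℤ} {x : ℝ} (hx : x ∈ dyadicIco k m) :
    dyadicCell k x = dyadicIco k m := by
  rw [dyadicCell, mem_dyadicIco_iff.1 hx]

theorem measurable_dyadicIndex (k : ℤ) : Measurable (dyadicIndex k) :=
  Int.measurable_floor.comp (measurable_id.mul_const _)

theorem measurableSet_dyadicIco (k m : ℤ) : MeasurableSet (dyadicIco k m) := measurableSet_Ico

theorem measurableSet_dyadicCell (k : ℤ) (x : ℝ) : MeasurableSet (dyadicCell k x) :=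
  measurableSet_dyadicIco _ _

theorem dyadicIco_nonempty (k m : ℤ) : (dyadicIco k m).Nonempty := by
  refine ⟨m * 2 ^ (-k), ?_⟩
  rw [dyadicIco, Set.left_mem_Ico]
  have h2 : (0 : ℝ) < 2 ^ (-k) := by positivity
  nlinarith

theorem volume_dyadicIco (k m : ℤ) :
    volume (dyadicIco k m) = ENNReal.ofReal ((2 : ℝ) ^ (-k)) := by
  rw [dyadicIco, Real.volume_Ico]
  congr 1
  ring

theorem volume_dyadicIco_ne_top (k m : ℤ) : volume (dyadicIco k m) ≠ ∞ := by
  rw [volume_dyadicIco]; exact ENNReal.ofReal_ne_top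

theorem volume_dyadicIco_ne_zero (k m : ℤ) : volume (dyadicIco k m) ≠ 0 := by
  rw [volume_dyadicIco, Ne, ENNReal.ofReal_eq_zero, not_le]; positivity

theorem disjoint_dyadicIco (k : ℤ) : Pairwise (Function.onFun Disjoint (dyadicIco k)) := by
  intro a b hab
  rw [Function.onFun, Set.disjoint_left]
  intro x ha hb
  exact hab ((mem_dyadicIco_iff.1 ha).symm.trans (mem_dyadicIco_iff.1 hb))

theorem dyadicIndex_succ_ediv (k : ℤ) (x : ℝ) : dyadicIndex (k + 1) x / 2 = dyadicIndex k x := by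
  unfold dyadicIndex
  have h : x * (2 : ℝ) ^ (k + 1) = 2 * (x * 2 ^ k) := by
    rw [zpow_add₀ two_ne_zero]; ring
  rw [h]
  set y := x * (2 : ℝ) ^ k
  have h1 := Int.floor_le y
  have h2 := Int.lt_floor_add_one y
  have h3 : 2 * ⌊y⌋ ≤ ⌊2 * y⌋ := by rw [Int.le_floor]; push_cast; linarith
  have h4 : ⌊2 * y⌋ < 2 * ⌊y⌋ + 2 := by rw [Int.floor_lt]; push_cast; linarith
  omega

theorem dyadicIndex_eq_of_le {k l : ℤ} (hkl : k ≤ l) {x y : ℝ}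
    (h : dyadicIndex l x = dyadicIndex l y) : dyadicIndex k x = dyadicIndex k y := by
  induction l, hkl using Int.leInduction with
  | base => exact h
  | succ l _ ih => exact ih (by rw [← dyadicIndex_succ_ediv, h, dyadicIndex_succ_ediv])

theorem dyadicCell_subset {k l : ℤ} (hkl : k ≤ l) (x : ℝ) : dyadicCell l x ⊆ dyadicCell k x := by
  intro y hy
  rw [mem_dyadicCell_iff] at *
  exact dyadicIndex_eq_of_le hkl hy

theorem dyadicIco_subset_or_disjoint {k l : ℤ} (hkl : k ≤ l) (a b : ℤ) :
    dyadicIco l b ⊆ dyadicIco k a ∨ Disjoint (dyadicIco k a) (dyadicIco l b) := by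
  by_cases h : Disjoint (dyadicIco k a) (dyadicIco l b)
  · exact Or.inr h
  · obtain ⟨x, hx, hy⟩ := Set.not_disjoint_iff.1 h
    rw [← dyadicCell_eq_of_mem hx, ← dyadicCell_eq_of_mem hy]
    exact Or.inl (dyadicCell_subset hkl x)

namespace DyadicAdapted

variable {β γ : Type*} {k l : ℤ} {h : ℝ → β}

theorem mono (hh : DyadicAdapted k h) (hkl : k ≤ l) : DyadicAdapted l h :=
  fun x y hxy => hh x y (dyadicIndex_eq_of_le hkl hxy)

theorem comp (g : β → γ) (hh : DyadicAdapted k h) : DyadicAdapted k fun x => g (h x) :=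
  fun x y hxy => congrArg g (hh x y hxy)

theorem comp₂ {δ : Type*} {h' : ℝ → γ} (g : β → γ → δ) (hh : DyadicAdapted k h)
    (hh' : DyadicAdapted k h') : DyadicAdapted k fun x => g (h x) (h' x) :=
  fun x y hxy => congrArg₂ g (hh x y hxy) (hh' x y hxy)

theorem eq_comp (hh : DyadicAdapted k h) :
    h = (fun m : ℤ => h (m * 2 ^ (-k))) ∘ dyadicIndex k := by
  funext x
  apply hh
  symm
  rw [← mem_dyadicIco_iff, dyadicIco, Set.left_mem_Ico]
  have h2 : (0 : ℝ) < 2 ^ (-k) := by positivity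
  nlinarith

/-- The function factors through an integer-valued index, and every map out of `ℤ` is measurable.
This also covers suprema over uncountably many time sequences, as in `pathVariation`. -/
theorem measurable [MeasurableSpace β] (hh : DyadicAdapted k h) : Measurable h := by
  rw [hh.eq_comp]
  exact (measurable_of_countable _).comp (measurable_dyadicIndex k)

theorem measurableSet {p : ℝ → Prop} (hp : DyadicAdapted k p) : MeasurableSet {x | p x} :=
  measurableSet_setOfPred.2 hp.measurable

theorem eq_of_mem {m : ℤ} {x y : ℝ} (hh : DyadicAdapted k h) (hx : x ∈ dyadicIco k m)
    (hy : y ∈ dyadicIco k m) : h x = h y :=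
  hh x y ((mem_dyadicIco_iff.1 hx).trans (mem_dyadicIco_iff.1 hy).symm)

end DyadicAdapted

theorem dyadicAdapted_mem_dyadicIco (k m : ℤ) : DyadicAdapted k (· ∈ dyadicIco k m) := by
  intro x y h
  simp only [mem_dyadicIco_iff, h]

theorem finite_dyadicIndex_image (l k m : ℤ) : (dyadicIndex l '' dyadicIco k m).Finite := by
  refine (Set.finite_Icc (dyadicIndex l (m * 2 ^ (-k))) (dyadicIndex l ((m + 1) * 2 ^ (-k)))).subset
    ?_
  rintro _ ⟨x, hx, rfl⟩
  have h2 : (0 : ℝ) < 2 ^ l := by positivity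
  exact ⟨Int.floor_le_floor (by nlinarith [hx.1]), Int.floor_le_floor (by nlinarith [hx.2])⟩

/-- A function adapted to some generation takes finitely many values on a dyadic interval. -/
theorem DyadicAdapted.finite_image {β : Type*} {l : ℤ} {h : ℝ → β} (hh : DyadicAdapted l h)
    (k m : ℤ) : (h '' dyadicIco k m).Finite := by
  rw [hh.eq_comp, Set.image_comp]
  exact (finite_dyadicIndex_image l k m).image _

theorem DyadicAdapted.integrableOn {E : Type*} [NormedAddCommGroup E] [MeasurableSpace E]
    [BorelSpace E] [SecondCountableTopology E] {l : ℤ} {h : ℝ → E} (hh : DyadicAdapted l h)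
    (k m : ℤ) : IntegrableOn h (dyadicIco k m) := by
  obtain ⟨M, hM⟩ := ((hh.comp norm).finite_image k m).bddAbove
  refine Measure.integrableOn_of_bounded (M := M) (volume_dyadicIco_ne_top k m)
    hh.measurable.aestronglyMeasurable ?_
  refine (ae_restrict_iff' (measurableSet_dyadicIco k m)).2 (Filter.Eventually.of_forall ?_)
  exact fun x hx => hM (Set.mem_image_of_mem _ hx)

theorem iUnion_inter_dyadicIco (k : ℤ) (E : Set ℝ) : ⋃ m, E ∩ dyadicIco k m = E := by
  ext x
  simp only [Set.mem_iUnion, Set.mem_inter_iff, mem_dyadicIco_iff, exists_and_left, exists_eq',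
    and_true]

theorem disjoint_inter_dyadicIco (k : ℤ) (E : Set ℝ) :
    Pairwise (Function.onFun Disjoint fun m => E ∩ dyadicIco k m) := fun _ _ hab =>
  (disjoint_dyadicIco k hab).mono Set.inter_subset_right Set.inter_subset_right

theorem DyadicAdapted.inter_dyadicIco_eq {k : ℤ} {E : Set ℝ} (hE : DyadicAdapted k (· ∈ E))
    (m : ℤ) : dyadicIco k m ⊆ E ∨ E ∩ dyadicIco k m = ∅ := by
  by_cases h : E ∩ dyadicIco k m = ∅
  · exact Or.inr h
  · obtain ⟨x, hx, hx'⟩ := Set.nonempty_iff_ne_empty.2 h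
    exact Or.inl fun y hy => (hE.eq_of_mem hx' hy).mp hx

/-- Two measures can be compared on a union of dyadic intervals of the same length by comparing
them on each of the intervals. -/
theorem measure_le_of_forall_dyadicIco_le {μ ν : Measure ℝ} {k : ℤ} {E : Set ℝ}
    (hE : DyadicAdapted k (· ∈ E))
    (h : ∀ m, dyadicIco k m ⊆ E → μ (dyadicIco k m) ≤ ν (dyadicIco k m)) : μ E ≤ ν E := by
  have hm : ∀ m, MeasurableSet (E ∩ dyadicIco k m) := fun m =>
    hE.measurableSet.inter (measurableSet_dyadicIco k m)
  rw [← iUnion_inter_dyadicIco k E, measure_iUnion (disjoint_inter_dyadicIco k E) hm,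
    measure_iUnion (disjoint_inter_dyadicIco k E) hm]
  refine ENNReal.tsum_le_tsum fun m => ?_
  rcases hE.inter_dyadicIco_eq m with h' | h'
  · rw [Set.inter_eq_right.2 h']; exact h m h'
  · simp [h']

/-- An integral over a dyadic interval vanishes if it vanishes over each smaller interval of some
generation. -/
theorem integral_eq_zero_of_forall_dyadicIco {g : ℝ → ℂ} {k l m : ℤ} (hkl : k ≤ l)
    (hg : IntegrableOn g (dyadicIco k m))
    (h : ∀ b, dyadicIco l b ⊆ dyadicIco k m → ∫ x in dyadicIco l b, g x = 0) :
    ∫ x in dyadicIco k m, g x = 0 := by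
  have hE := (dyadicAdapted_mem_dyadicIco k m).mono hkl
  have hm : ∀ b, MeasurableSet (dyadicIco k m ∩ dyadicIco l b) := fun b =>
    (measurableSet_dyadicIco k m).inter (measurableSet_dyadicIco l b)
  rw [← iUnion_inter_dyadicIco l (dyadicIco k m),
    integral_iUnion hm (disjoint_inter_dyadicIco l _) (by rwa [iUnion_inter_dyadicIco])]
  refine (tsum_congr fun b => ?_).trans tsum_zero
  rcases hE.inter_dyadicIco_eq b with h' | h'
  · rw [Set.inter_eq_right.2 h']; exact h b h'
  · simp [h']

/-! ### Layer cake formula and good-`λ` inequalities. -/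

/-- The layer cake formula for extended nonnegative functions. -/
theorem lintegral_rpow_eq_lintegral_meas_ofReal_lt {α : Type*} [MeasurableSpace α]
    (μ : Measure α) {f : α → ℝ≥0∞} (hf : Measurable f) {p : ℝ} (hp : 0 < p) :
    ∫⁻ a, f a ^ p ∂μ = ENNReal.ofReal p *
      ∫⁻ t in Set.Ioi (0 : ℝ), μ {a | ENNReal.ofReal t < f a} * ENNReal.ofReal (t ^ (p - 1)) := by
  by_cases htop : μ {a | f a = ∞} = 0
  · have hlt : ∀ᵐ a ∂μ, f a ≠ ∞ := ae_iff.2 (by simpa using htop)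
    have h1 : ∫⁻ a, f a ^ p ∂μ = ∫⁻ a, ENNReal.ofReal ((f a).toReal ^ p) ∂μ := by
      refine lintegral_congr_ae (hlt.mono fun a ha => ?_)
      change f a ^ p = ENNReal.ofReal ((f a).toReal ^ p)
      rw [← ENNReal.ofReal_rpow_of_nonneg ENNReal.toReal_nonneg hp.le, ENNReal.ofReal_toReal ha]
    rw [h1, lintegral_rpow_eq_lintegral_meas_lt_mul μ
      (Filter.Eventually.of_forall fun a => ENNReal.toReal_nonneg)
      hf.ennreal_toReal.aemeasurable hp]
    congr 1
    refine setLIntegral_congr_fun measurableSet_Ioi fun t ht => ?_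
    congr 1
    refine measure_congr (hlt.mono fun a ha => ?_)
    exact propext (ENNReal.ofReal_lt_iff_lt_toReal (le_of_lt ht) ha).symm
  · have h1 : ∫⁻ a, f a ^ p ∂μ = ∞ := by
      by_contra h
      have := ae_lt_top (hf.pow_const p) h
      refine htop (measure_mono_null ?_ this)
      intro a (ha : f a = ∞) (hc : f a ^ p < ∞)
      rw [ha, ENNReal.top_rpow_of_pos hp] at hc
      exact lt_irrefl _ hc
    -- No power is integrable over the whole half-line, so a set of positive measure where `f = ∞`
    -- makes both sides infinite.
    have h2 : ∫⁻ t in Set.Ioi (0 : ℝ), ENNReal.ofReal (t ^ (p - 1)) = ∞ := by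
      by_contra h
      refine not_integrableOn_Ioi_rpow (p - 1) ⟨?_, ?_⟩
      · exact (measurable_id.pow_const _).aestronglyMeasurable
      · rw [hasFiniteIntegral_iff_enorm]
        refine lt_of_le_of_lt (le_of_eq ?_) (lt_top_iff_ne_top.2 h)
        refine setLIntegral_congr_fun measurableSet_Ioi fun t ht => ?_
        exact Real.enorm_of_nonneg (Real.rpow_nonneg (le_of_lt ht) _)
    rw [h1]
    symm
    refine ENNReal.mul_eq_top.2 (Or.inl ⟨by simpa using hp, ?_⟩)
    rw [eq_top_iff]
    calc (∞ : ℝ≥0∞) = μ {a | f a = ∞} * ∫⁻ t in Set.Ioi (0 : ℝ), ENNReal.ofReal (t ^ (p - 1)) := by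
          rw [h2, ENNReal.mul_top htop]
      _ = ∫⁻ t in Set.Ioi (0 : ℝ), μ {a | f a = ∞} * ENNReal.ofReal (t ^ (p - 1)) := by
          rw [lintegral_const_mul _ (by fun_prop)]
      _ ≤ _ := by
          refine lintegral_mono fun t => mul_le_mul_left (measure_mono fun a ha => ?_) _
          rw [Set.mem_ofPred_eq] at ha ⊢
          rw [ha]; exact ENNReal.ofReal_lt_top

/-- If `s < 1`, a good-`λ` inequality gives moment bounds on finite measure spaces. -/
theorem exists_lintegral_rpow_le_of_good_lambda {p : ℝ} (hp : 0 < p) {θ C : ℝ≥0} (hθ : θ < 1)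
    (hC : 0 < C) : ∃ A : ℝ≥0, ∀ (μ : Measure ℝ) [IsFiniteMeasure μ] (X B : ℝ → ℝ≥0∞),
      Measurable X → Measurable B →
      (∀ t b : ℝ≥0, 0 < t → 0 < b →
        μ {x | t + C * b < X x} ≤ μ {x | b < B x} + θ * μ {x | t < X x}) →
      ∫⁻ x, X x ^ p ∂μ ≤ A * ∫⁻ x, B x ^ p ∂μ := by
  -- Any `s` strictly between `θ` and `1` would do. With `κ = s^(-1/p) > 1`, dividing `X` by `κ`
  -- multiplies its `p`-th moment by `s`, and `s > θ` allows the term `θ ∫ X^p` to be absorbed.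
  set s : ℝ≥0 := (θ + 1) / 2 with hs
  have hθs : θ < s := by rw [← NNReal.coe_lt_coe] at *; push_cast [hs] at *; linarith
  have hs1 : s < 1 := by rw [← NNReal.coe_lt_coe] at *; push_cast [hs] at *; linarith
  have hs0 : 0 < s := lt_of_le_of_lt (zero_le) hθs
  set κ : ℝ≥0 := s ^ (-(1 / p)) with hκ
  have hκ1 : 1 < κ := NNReal.one_lt_rpow_of_pos_of_lt_one_of_neg hs0 hs1 (by simpa using hp)
  have hκp : (κ⁻¹) ^ p = s := by
    rw [hκ, NNReal.inv_rpow, ← NNReal.rpow_mul, ← NNReal.rpow_neg]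
    convert NNReal.rpow_one s using 2
    field_simp
  -- Chosen so that `t + C * (γ * t) = κ * t`; the hypothesis is used with `b = γ * t`.
  set γ : ℝ≥0 := (κ - 1) / C with hγ
  have hγ0 : 0 < γ := div_pos (tsub_pos_of_lt hκ1) hC
  have hγκ : 1 + C * γ = κ := by
    rw [hγ, mul_div_cancel₀ _ hC.ne', add_tsub_cancel_of_le hκ1.le]
  refine ⟨(γ⁻¹) ^ p / (s - θ), ?_⟩
  intro μ _ X B hX hB h
  have key : ∀ Y : ℝ → ℝ≥0∞, Measurable Y → ∫⁻ x, Y x ^ p ∂μ ≠ ∞ →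
      (∀ t : ℝ≥0, 0 < t → μ {x | κ * t < Y x} ≤ μ {x | γ * t < B x} + θ * μ {x | t < Y x}) →
      ∫⁻ x, Y x ^ p ∂μ ≤ ((γ⁻¹) ^ p / (s - θ) : ℝ≥0) * ∫⁻ x, B x ^ p ∂μ := by
    intro Y hY hfin hgood
    have hsc : ∀ (c : ℝ≥0) (Z : ℝ → ℝ≥0∞), Measurable Z →
        ∫⁻ x, ((c⁻¹ : ℝ≥0) * Z x) ^ p ∂μ = ((c⁻¹ ^ p : ℝ≥0) : ℝ≥0∞) * ∫⁻ x, Z x ^ p ∂μ := by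
      intro c Z hZ
      rw [← lintegral_const_mul _ (hZ.pow_const p)]
      refine lintegral_congr fun x => ?_
      rw [ENNReal.mul_rpow_of_nonneg _ _ hp.le, ENNReal.coe_rpow_of_nonneg _ hp.le]
    have hset : ∀ (c : ℝ≥0) (Z : ℝ → ℝ≥0∞) (t : ℝ), 0 < c →
        {x | ENNReal.ofReal t < (c⁻¹ : ℝ≥0) * Z x} = {x | c * (t.toNNReal : ℝ≥0∞) < Z x} := by
      intro c Z t hc
      ext x
      have hc' : (c : ℝ≥0∞) ≠ 0 := by simpa using hc.ne'
      rw [Set.mem_ofPred_eq, Set.mem_ofPred_eq, ENNReal.coe_inv hc.ne', mul_comm _ (Z x),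
        ← div_eq_mul_inv, ENNReal.lt_div_iff_mul_lt (Or.inl hc') (Or.inl ENNReal.coe_ne_top),
        mul_comm, ENNReal.ofReal]
    have h1 : ∫⁻ x, ((κ⁻¹ : ℝ≥0) * Y x) ^ p ∂μ ≤
        ∫⁻ x, ((γ⁻¹ : ℝ≥0) * B x) ^ p ∂μ + θ * ∫⁻ x, Y x ^ p ∂μ := by
      have hmeas : Measurable fun t : ℝ =>
          μ {a | ENNReal.ofReal t < (γ⁻¹ : ℝ≥0) * B a} * ENNReal.ofReal (t ^ (p - 1)) := by
        refine Measurable.mul (Antitone.measurable fun a b hab => measure_mono fun x hx => ?_)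
          (by fun_prop)
        exact lt_of_le_of_lt (ENNReal.ofReal_le_ofReal hab) hx
      have hθm : ∀ a : ℝ≥0∞, (θ : ℝ≥0∞) * (ENNReal.ofReal p * a) = ENNReal.ofReal p * (θ * a) :=
        fun a => by ring
      rw [lintegral_rpow_eq_lintegral_meas_ofReal_lt μ (hY.const_mul _) hp,
        lintegral_rpow_eq_lintegral_meas_ofReal_lt μ (hB.const_mul _) hp,
        lintegral_rpow_eq_lintegral_meas_ofReal_lt μ hY hp, hθm, ← mul_add,
        ← lintegral_const_mul' _ _ ENNReal.coe_ne_top, ← lintegral_add_left hmeas]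
      refine mul_le_mul_right (setLIntegral_mono' measurableSet_Ioi fun t ht => ?_) _
      rw [hset κ Y t (zero_lt_one.trans hκ1), hset γ B t hγ0, ← mul_assoc, ← add_mul]
      exact mul_le_mul_left (hgood t.toNNReal (Real.toNNReal_pos.2 ht)) _
    rw [hsc κ Y hY, hsc γ B hB, hκp] at h1
    have hd : ((s - θ : ℝ≥0) : ℝ≥0∞) * ∫⁻ x, Y x ^ p ∂μ ≤
        ((γ⁻¹ ^ p : ℝ≥0) : ℝ≥0∞) * ∫⁻ x, B x ^ p ∂μ := by
      rw [ENNReal.coe_sub, ENNReal.sub_mul fun _ _ => hfin]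
      exact tsub_le_iff_right.2 h1
    have hd0 : s - θ ≠ 0 := (tsub_pos_of_lt hθs).ne'
    rw [ENNReal.coe_div hd0, ENNReal.mul_comm_div, mul_div_assoc', ENNReal.le_div_iff_mul_le
      (Or.inl (ENNReal.coe_ne_zero.2 hd0)) (Or.inl ENNReal.coe_ne_top), mul_comm]
    exact hd
  -- Absorption needs a finite moment, supplied by truncating at `R` on a finite measure space. The
  -- good-`λ` inequality survives: for `R ≤ κ * t` the left set is empty, and otherwise both levels
  -- lie below `R`, where truncation is invisible.
  have htrunc : ∀ R : ℕ, ∫⁻ x, min (X x) R ^ p ∂μ ≤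
      ((γ⁻¹) ^ p / (s - θ) : ℝ≥0) * ∫⁻ x, B x ^ p ∂μ := by
    intro R
    refine key _ (hX.min measurable_const) ?_ ?_
    · refine ne_top_of_le_ne_top ?_ (lintegral_mono fun x => ENNReal.rpow_le_rpow
        (min_le_right (X x) (R : ℝ≥0∞)) hp.le)
      rw [lintegral_const]
      exact ENNReal.mul_ne_top (ENNReal.rpow_ne_top_of_nonneg hp.le (ENNReal.natCast_ne_top R))
        (measure_ne_top _ _)
    · intro t ht
      by_cases hR : (R : ℝ≥0∞) ≤ κ * t
      · refine le_trans (le_of_eq ?_) zero_le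
        convert measure_empty (μ := μ)
        ext x
        simp [hR]
      · have htR : (t : ℝ≥0∞) < R := by
          refine lt_of_le_of_lt ?_ (not_le.1 hR)
          exact le_mul_of_one_le_left zero_le (by exact_mod_cast hκ1.le)
        have e : ∀ u : ℝ≥0∞, u < R → {x | u < min (X x) (R : ℝ≥0∞)} = {x | u < X x} := by
          intro u hu
          ext x
          simp [hu]
        rw [e _ (not_le.1 hR), e _ htR]
        have := h t (γ * t) ht (mul_pos hγ0 ht)
        rw [ENNReal.coe_mul] at this
        convert this using 5
        rw [← hγκ]
        push_cast
        ring
  have hsup : ∫⁻ x, X x ^ p ∂μ = ⨆ R : ℕ, ∫⁻ x, min (X x) R ^ p ∂μ := by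
    rw [← lintegral_iSup]
    · refine lintegral_congr fun x => ?_
      refine Eq.trans ?_ ((ENNReal.orderIsoRpow p hp).map_iSup
        fun R : ℕ => min (X x) (R : ℝ≥0∞))
      change _ = (⨆ R : ℕ, min (X x) (R : ℝ≥0∞)) ^ p
      congr 1
      have := inf_iSup_eq (X x) (fun R : ℕ => (R : ℝ≥0∞))
      rw [ENNReal.iSup_natCast, inf_top_eq] at this
      exact this
    · exact fun R => (hX.min measurable_const).pow_const p
    · intro a b hab x
      exact ENNReal.rpow_le_rpow (min_le_min_left _ (by exact_mod_cast hab)) hp.le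
  rw [hsup]
  exact iSup_le htrunc

/-! ### The dyadic maximal function of a general measure. -/

/-- The average of `g` with respect to `μ` over the dyadic interval of length `2⁻ᵏ` around `x`. -/
noncomputable def dyadicAvg (μ : Measure ℝ) (g : ℝ → ℝ≥0∞) (k : ℤ) (x : ℝ) : ℝ≥0∞ :=
  (∫⁻ y in dyadicCell k x, g y ∂μ) / μ (dyadicCell k x)

/-- The maximal function over dyadic intervals of lengths `2⁻ᴷ, …, 2⁻⁽ᴷ⁺ⁿ⁾`. -/
noncomputable def dyadicMax (μ : Measure ℝ) (g : ℝ → ℝ≥0∞) (K : ℤ) (n : ℕ) (x : ℝ) : ℝ≥0∞ :=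
  ⨆ (j : ℕ) (_ : j ≤ n), dyadicAvg μ g (K + j) x

theorem dyadicAdapted_cell (k : ℤ) : DyadicAdapted k (dyadicCell k) := fun x y h => by
  rw [dyadicCell, dyadicCell, h]

theorem dyadicAdapted_avg (μ : Measure ℝ) (g : ℝ → ℝ≥0∞) (k : ℤ) :
    DyadicAdapted k (dyadicAvg μ g k) :=
  (dyadicAdapted_cell k).comp fun s => (∫⁻ y in s, g y ∂μ) / μ s

theorem dyadicAdapted_max (μ : Measure ℝ) (g : ℝ → ℝ≥0∞) (K : ℤ) (n : ℕ) :
    DyadicAdapted (K + n) (dyadicMax μ g K n) := by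
  intro x y h
  refine iSup_congr fun j => iSup_congr fun hj => ?_
  exact (dyadicAdapted_avg μ g (K + j)).mono (by omega) x y h

theorem dyadicAvg_le_dyadicMax (μ : Measure ℝ) (g : ℝ → ℝ≥0∞) (K : ℤ) {j n : ℕ} (hj : j ≤ n)
    (x : ℝ) : dyadicAvg μ g (K + j) x ≤ dyadicMax μ g K n x :=
  le_iSup₂ (f := fun (j : ℕ) (_ : j ≤ n) => dyadicAvg μ g (K + j) x) j hj

theorem dyadicMax_mono (μ : Measure ℝ) (g : ℝ → ℝ≥0∞) (K : ℤ) {m n : ℕ} (h : m ≤ n) (x : ℝ) :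
    dyadicMax μ g K m x ≤ dyadicMax μ g K n x :=
  iSup₂_le fun _ hj => dyadicAvg_le_dyadicMax μ g K (hj.trans h) x

theorem lt_dyadicMax_iff {μ : Measure ℝ} {g : ℝ → ℝ≥0∞} {K : ℤ} {n : ℕ} {x : ℝ} {t : ℝ≥0∞} :
    t < dyadicMax μ g K n x ↔ ∃ j ≤ n, t < dyadicAvg μ g (K + j) x := by
  simp only [dyadicMax, lt_iSup_iff, exists_prop]

/-- Decomposition by stopping time: when `A j` says that a level is exceeded at time `j`, the set
`disjointed A j` says that this happens at time `j` for the first time. -/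
theorem measure_biUnion_le_of_disjointed {μ ν : Measure ℝ} {A : ℕ → Set ℝ}
    (hA : ∀ j, MeasurableSet (A j)) (n : ℕ)
    (h : ∀ j ≤ n, μ (disjointed A j) ≤ ν (disjointed A j)) :
    μ (⋃ j ∈ Finset.range (n + 1), A j) ≤ ν (⋃ j ∈ Finset.range (n + 1), A j) := by
  have hm : ∀ j, MeasurableSet (disjointed A j) := fun j => MeasurableSet.disjointed hA j
  have hd : (↑(Finset.range (n + 1)) : Set ℕ).PairwiseDisjoint (disjointed A) :=
    (disjoint_disjointed A).set_pairwise _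
  have hU : ⋃ j ∈ Finset.range (n + 1), A j = ⋃ j ∈ Finset.range (n + 1), disjointed A j := by
    rw [biUnion_range_succ_disjointed, partialSups_eq_biUnion_range]
  rw [hU, measure_biUnion_finset hd fun j _ => hm j, measure_biUnion_finset hd fun j _ => hm j]
  exact Finset.sum_le_sum fun j hj => h j (Nat.lt_succ_iff.1 (Finset.mem_range.1 hj))

/-- Being the first time is decided by the generations up to `K + n`, so each piece is a union of
dyadic intervals of that generation and can be treated interval by interval. -/
theorem dyadicAdapted_mem_disjointed {K : ℤ} {A : ℕ → Set ℝ}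
    (hA : ∀ j : ℕ, DyadicAdapted (K + j) (· ∈ A j)) (n : ℕ) :
    DyadicAdapted (K + n) (· ∈ disjointed A n) := by
  intro x y h
  have hj : ∀ j ≤ n, (x ∈ A j ↔ y ∈ A j) := fun j hj =>
    Iff.of_eq (((hA j).mono (by omega)) x y h)
  refine propext ?_
  simp only [disjointed_eq_inter_compl, Set.mem_inter_iff, Set.mem_iInter, Set.mem_compl_iff]
  rw [hj n le_rfl]
  refine and_congr_right fun _ => forall₂_congr fun j hjn => ?_
  rw [hj j hjn.le]

/-- The weak type `(1, 1)` inequality for the dyadic maximal function. -/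
theorem mul_measure_lt_dyadicMax_le (μ : Measure ℝ) (g : ℝ → ℝ≥0∞) (K : ℤ) (n : ℕ) {E : Set ℝ}
    (hE : DyadicAdapted K (· ∈ E)) (t : ℝ≥0∞) :
    t * μ (E ∩ {x | t < dyadicMax μ g K n x}) ≤ ∫⁻ x in E, g x ∂μ := by
  set A : ℕ → Set ℝ := fun j => {x | x ∈ E ∧ t < dyadicAvg μ g (K + j) x} with hA
  have hAa : ∀ j : ℕ, DyadicAdapted (K + j) (· ∈ A j) := fun j =>
    (hE.mono (by omega)).comp₂ And ((dyadicAdapted_avg μ g (K + j)).comp (t < ·))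
  have hAm : ∀ j, MeasurableSet (A j) := fun j => (hAa j).measurableSet
  have hU : E ∩ {x | t < dyadicMax μ g K n x} = ⋃ j ∈ Finset.range (n + 1), A j := by
    ext x
    simp only [Set.mem_inter_iff, Set.mem_ofPred_eq, lt_dyadicMax_iff, Set.mem_iUnion,
      Finset.mem_range, Nat.lt_succ_iff, exists_prop, hA]
    tauto
  have h := measure_biUnion_le_of_disjointed (μ := t • μ) (ν := μ.withDensity g) hAm n
    fun j _ => measure_le_of_forall_dyadicIco_le (dyadicAdapted_mem_disjointed hAa j) fun m hm => by
      obtain ⟨x, hx⟩ := dyadicIco_nonempty (K + j) m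
      have hx' : t < dyadicAvg μ g (K + j) x := (disjointed_subset A j (hm hx)).2
      rw [dyadicAvg, dyadicCell_eq_of_mem hx] at hx'
      rw [withDensity_apply _ (measurableSet_dyadicIco _ _), Measure.smul_apply, smul_eq_mul]
      exact ENNReal.mul_le_of_le_div hx'.le
  rw [← hU, withDensity_apply _ (by
    exact hE.measurableSet.inter ((dyadicAdapted_max μ g K n).comp (t < ·)).measurableSet),
    Measure.smul_apply, smul_eq_mul] at h
  exact h.trans (lintegral_mono_set Set.inter_subset_left)

/-- Doob's inequality for the dyadic maximal function of an arbitrary measure. -/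
theorem lintegral_dyadicMax_rpow_le {q : ℝ} (hq : 1 < q) (μ : Measure ℝ) {g : ℝ → ℝ≥0∞}
    (hg : Measurable g) (K : ℤ) (n : ℕ) :
    ∫⁻ x, dyadicMax μ g K n x ^ q ∂μ ≤
      ENNReal.ofReal (2 ^ q * (q / (q - 1))) * ∫⁻ x, g x ^ q ∂μ := by
  have hq0 : 0 < q := zero_lt_one.trans hq
  have hq1 : 0 < q - 1 := sub_pos.2 hq
  have hM : Measurable (dyadicMax μ g K n) := (dyadicAdapted_max μ g K n).measurable
  -- Cutting `g` off where it is at most `u` lowers every average by at most `u`. So maximal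
  -- function above `2u` forces that of `g' = g 1_{g > u}` above `u`, and the weak type inequality
  -- for `g'` applies.
  have hweak : ∀ t : ℝ, 0 < t → ENNReal.ofReal t * μ {x | ENNReal.ofReal t < 2⁻¹ *
      dyadicMax μ g K n x} ≤ (μ.withDensity g) {x | ENNReal.ofReal t < g x} := by
    intro t ht
    set u := ENNReal.ofReal t
    have hm : MeasurableSet {x | u < g x} := measurableSet_lt measurable_const hg
    set g' : ℝ → ℝ≥0∞ := {x | u < g x}.indicator g
    have hg' : ∀ x, g x ≤ g' x + u := by
      intro x
      by_cases hx : u < g x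
      · have : g' x = g x := Set.indicator_of_mem (s := {x | u < g x}) hx g
        rw [this]; exact le_self_add
      · exact (not_lt.1 hx).trans le_add_self
    have hsub : {x | u < 2⁻¹ * dyadicMax μ g K n x} ⊆
        Set.univ ∩ {x | u < dyadicMax μ g' K n x} := by
      intro x hx
      refine ⟨Set.mem_univ _, ?_⟩
      have hx2 : 2 * u < dyadicMax μ g K n x := by
        have : u < 2⁻¹ * dyadicMax μ g K n x := hx
        rw [mul_comm, ← div_eq_mul_inv, ENNReal.lt_div_iff_mul_lt (by simp) (by simp)] at this
        rwa [mul_comm]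
      obtain ⟨j, hj, hjx⟩ := lt_dyadicMax_iff.1 hx2
      refine lt_dyadicMax_iff.2 ⟨j, hj, ?_⟩
      have h1 : dyadicAvg μ g (K + j) x ≤ dyadicAvg μ g' (K + j) x + u := by
        rw [dyadicAvg, dyadicAvg]
        refine (ENNReal.div_le_div_right (lintegral_mono hg') _).trans ?_
        rw [lintegral_add_right _ measurable_const, setLIntegral_const, ENNReal.add_div]
        gcongr
        rw [mul_div_assoc]
        exact mul_le_of_le_one_right zero_le ENNReal.div_self_le_one
      by_contra hcon
      refine absurd (hjx.trans_le (h1.trans (add_le_add_left (not_lt.1 hcon) u))) ?_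
      rw [two_mul]
      exact lt_irrefl _
    calc u * μ {x | u < 2⁻¹ * dyadicMax μ g K n x}
        ≤ u * μ (Set.univ ∩ {x | u < dyadicMax μ g' K n x}) := by gcongr
      _ ≤ ∫⁻ x in Set.univ, g' x ∂μ :=
          mul_measure_lt_dyadicMax_le μ g' K n (fun _ _ _ => by simp) u
      _ = (μ.withDensity g) {x | u < g x} := by
          rw [withDensity_apply _ hm, Measure.restrict_univ, lintegral_indicator hm]
  -- The weak bound is the `g dμ`-measure of a level set of `g`, so the layer cake formula is
  -- applied to `g dμ` with exponent `q - 1`.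
  have hlayer := lintegral_rpow_eq_lintegral_meas_ofReal_lt (μ.withDensity g) hg hq1
  rw [lintegral_withDensity_eq_lintegral_mul _ hg (hg.pow_const _)] at hlayer
  have hgq : ∫⁻ x, g x ^ q ∂μ = ∫⁻ x, (g * fun x => g x ^ (q - 1)) x ∂μ := by
    refine lintegral_congr fun x => ?_
    rw [Pi.mul_apply]
    nth_rw 2 [← ENNReal.rpow_one (g x)]
    rw [← ENNReal.rpow_add_of_nonneg _ _ zero_le_one hq1.le, add_sub_cancel]
  have hhalf : ∫⁻ x, (2⁻¹ * dyadicMax μ g K n x) ^ q ∂μ ≤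
      ENNReal.ofReal (q / (q - 1)) * ∫⁻ x, g x ^ q ∂μ := by
    rw [lintegral_rpow_eq_lintegral_meas_ofReal_lt μ (hM.const_mul _) hq0, hgq, hlayer,
      ← mul_assoc, ← ENNReal.ofReal_mul (by positivity), div_mul_cancel₀ _ hq1.ne']
    refine mul_le_mul_right (setLIntegral_mono' measurableSet_Ioi fun t (ht : 0 < t) => ?_) _
    have : t ^ (q - 1) = t * t ^ (q - 1 - 1) := by
      rw [Real.rpow_sub_one ht.ne' (q - 1)]; field_simp
    rw [this, ENNReal.ofReal_mul ht.le, ← mul_assoc, mul_comm (μ _)]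
    exact mul_le_mul_left (hweak t ht) _
  have h2 : ∫⁻ x, dyadicMax μ g K n x ^ q ∂μ =
      ENNReal.ofReal (2 ^ q) * ∫⁻ x, (2⁻¹ * dyadicMax μ g K n x) ^ q ∂μ := by
    rw [← lintegral_const_mul _ ((hM.const_mul _).pow_const q)]
    refine lintegral_congr fun x => ?_
    rw [← ENNReal.ofReal_rpow_of_pos two_pos, ← ENNReal.mul_rpow_of_nonneg _ _ hq0.le,
      ← mul_assoc, ENNReal.ofReal_ofNat, ENNReal.mul_inv_cancel (by simp) (by simp), one_mul]
  rw [h2, ENNReal.ofReal_mul (by positivity), mul_assoc]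
  exact mul_le_mul_right hhalf _

/-! ### From growth on intervals to a good-`λ` inequality. -/

/-- A good-`λ` inequality for an increasing adapted process whose further growth over a dyadic
interval is controlled on a large part of the interval. -/
theorem measure_lt_le_of_dyadic_growth {μ : Measure ℝ} {K : ℤ} {L : ℕ} {X B : ℕ → ℝ → ℝ≥0∞}
    {θ C D : ℝ≥0} (hXa : ∀ n : ℕ, DyadicAdapted (K + n) (X n))
    (hBa : ∀ n : ℕ, DyadicAdapted (K + n) (B n)) (hX0 : ∀ x, X 0 x = 0)
    (hXm : ∀ n ≤ L, ∀ x, X n x ≤ X L x) (hBm : ∀ n ≤ L, ∀ x, B n x ≤ B L x)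
    (hstep : ∀ n x, X (n + 1) x ≤ X n x + D * B (n + 1) x)
    (hgrow : ∀ n ≤ L, ∀ (m : ℤ) (b : ℝ≥0), 0 < b → (∀ x ∈ dyadicIco (K + n) m, B n x ≤ b) →
      μ (dyadicIco (K + n) m ∩ {x | X n x + C * b < X L x}) ≤ θ * μ (dyadicIco (K + n) m))
    (t b : ℝ≥0) (hb : 0 < b) :
    μ {x | t + (D + C : ℝ≥0) * b < X L x} ≤ μ {x | b < B L x} + θ * μ {x | t < X L x} := by
  set S : Set ℝ := {x | t + (D + C : ℝ≥0) * b < X L x ∧ B L x ≤ b}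
  set A : ℕ → Set ℝ := fun j => {x | (t : ℝ≥0∞) < X j x} with hA
  have hAa : ∀ j : ℕ, DyadicAdapted (K + j) (· ∈ A j) := fun j =>
    (hXa j).comp ((t : ℝ≥0∞) < ·)
  have hAm : ∀ j, MeasurableSet (A j) := fun j => (hAa j).measurableSet
  have hU : ⋃ j ∈ Finset.range (L + 1), A j = {x | (t : ℝ≥0∞) < X L x} := by
    ext x
    simp only [Set.mem_ofPred_eq, Set.mem_iUnion, Finset.mem_range, Nat.lt_succ_iff, exists_prop,
      hA]
    exact ⟨fun ⟨j, hj, h⟩ => h.trans_le (hXm j hj x), fun h => ⟨L, le_rfl, h⟩⟩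
  have h := measure_biUnion_le_of_disjointed (μ := μ.restrict S) (ν := θ • μ) hAm L
    -- On an interval where `X` first exceeds `t` at time `j`, `X j ≤ t + D * b` unless `B j > b`.
    -- To pass `t + (D + C) * b` it must still grow by more than `C * b`, which `hgrow` allows only
    -- on a proportion `θ`.
    fun j hj => measure_le_of_forall_dyadicIco_le (dyadicAdapted_mem_disjointed hAa j)
      fun m hm => by
        rw [Measure.restrict_apply (measurableSet_dyadicIco _ _), Measure.smul_apply]
        change _ ≤ (θ : ℝ≥0∞) * _
        by_cases hB : ∀ x ∈ dyadicIco (K + j) m, B j x ≤ b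
        · refine le_trans (measure_mono ?_) (hgrow j hj m b hb hB)
          rintro x ⟨hx, hx1, hx2⟩
          refine ⟨hx, lt_of_le_of_lt ?_ hx1⟩
          have hxA := hm hx
          rw [disjointed_eq_inter_compl] at hxA
          rcases j with _ | j
          · exact absurd hxA.1 (by simp [hA, hX0])
          · have hxj : X j x ≤ t := by
              have := hxA.2
              simp only [Set.mem_iInter, Set.mem_compl_iff, hA, Set.mem_ofPred_eq, not_lt] at this
              exact this j (Nat.lt_succ_self j)
            calc X (j + 1) x + C * b ≤ (X j x + D * B (j + 1) x) + C * b := by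
                  gcongr; exact hstep j x
              _ ≤ (t + D * b) + C * b := by gcongr; exact hB x hx
              _ = t + (D + C : ℝ≥0) * b := by push_cast; ring
        -- `B j` is constant on the interval, so it exceeds `b` on all of it; then so does `B L`,
        -- and `S` misses the interval.
        · refine le_trans (le_of_eq ?_) zero_le
          convert measure_empty (μ := μ)
          push Not at hB
          obtain ⟨y, hy, hyB⟩ := hB
          rw [← Set.disjoint_iff_inter_eq_empty, Set.disjoint_left]
          rintro x hx ⟨_, hxB⟩
          rw [(hBa j).eq_of_mem hy hx] at hyB
          exact absurd hyB (not_lt.2 ((hBm j hj x).trans hxB))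
  rw [hU, Measure.restrict_apply (by
    rw [← hU]; exact Finset.measurableSet_biUnion _ fun j _ => hAm j)]
    at h
  calc μ {x | t + (D + C : ℝ≥0) * b < X L x}
      ≤ μ ({x | b < B L x} ∪ ({x | (t : ℝ≥0∞) < X L x} ∩ S)) := by
        refine measure_mono fun x hx => ?_
        by_cases hxB : B L x ≤ b
        · exact Or.inr ⟨lt_of_le_of_lt (b := (t : ℝ≥0∞) + (D + C : ℝ≥0) * b) le_self_add hx, hx,
            hxB⟩
        · exact Or.inl (not_le.1 hxB)
    _ ≤ _ := (measure_union_le _ _).trans (add_le_add_right h _)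

/-! ### Muckenhoupt weights. -/

/-- A weight that is measurable, everywhere positive and finite, and satisfies the dyadic `A_p`
condition with constant `Q`. -/
structure IsApWeight (p : ℝ) (W : ℝ → ℝ≥0∞) (Q : ℝ≥0) : Prop where
  one_le : 1 ≤ Q
  measurable : Measurable W
  ne_zero : ∀ x, W x ≠ 0
  ne_top : ∀ x, W x ≠ ∞
  mul_le : ∀ k m, (∫⁻ x in dyadicIco k m, W x) *
    (∫⁻ x in dyadicIco k m, W x ^ (-(1 / (p - 1)))) ^ (p - 1) ≤ Q * volume (dyadicIco k m) ^ p

theorem setLIntegral_dyadicIco_ne_zero {g : ℝ → ℝ≥0∞} (hg : Measurable g) (h0 : ∀ x, g x ≠ 0)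
    (k m : ℤ) : ∫⁻ x in dyadicIco k m, g x ≠ 0 := by
  rw [Ne, setLIntegral_eq_zero_iff (measurableSet_dyadicIco k m) hg]
  intro h
  refine volume_dyadicIco_ne_zero k m (measure_mono_null ?_ (ae_iff.1 h))
  intro x hx
  simp [hx, h0 x]

namespace IsApWeight

variable {p : ℝ} {W : ℝ → ℝ≥0∞} {Q : ℝ≥0}

theorem measurable_dual (hW : IsApWeight p W Q) : Measurable fun x => W x ^ (-(1 / (p - 1))) :=
  hW.measurable.pow_const _

theorem lintegral_ne_zero (hW : IsApWeight p W Q) (k m : ℤ) :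
    ∫⁻ x in dyadicIco k m, W x ≠ 0 :=
  setLIntegral_dyadicIco_ne_zero hW.measurable hW.ne_zero k m

theorem lintegral_dual_ne_zero (hW : IsApWeight p W Q) (k m : ℤ) :
    ∫⁻ x in dyadicIco k m, W x ^ (-(1 / (p - 1))) ≠ 0 :=
  setLIntegral_dyadicIco_ne_zero hW.measurable_dual
    (fun x => (ENNReal.rpow_pos (pos_iff_ne_zero.2 (hW.ne_zero x)) (hW.ne_top x)).ne') k m

theorem mul_ne_top (hp : 1 < p) (hW : IsApWeight p W Q) (k m : ℤ) :
    (∫⁻ x in dyadicIco k m, W x) *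
      (∫⁻ x in dyadicIco k m, W x ^ (-(1 / (p - 1)))) ^ (p - 1) ≠ ∞ :=
  ne_top_of_le_ne_top (ENNReal.mul_ne_top ENNReal.coe_ne_top (ENNReal.rpow_ne_top_of_nonneg
    (by linarith) (volume_dyadicIco_ne_top k m))) (hW.mul_le k m)

theorem lintegral_dual_ne_top (hp : 1 < p) (hW : IsApWeight p W Q) (k m : ℤ) :
    ∫⁻ x in dyadicIco k m, W x ^ (-(1 / (p - 1))) ≠ ∞ := by
  intro h
  refine hW.mul_ne_top hp k m ?_
  rw [h, ENNReal.top_rpow_of_pos (by linarith), ENNReal.mul_top (hW.lintegral_ne_zero k m)]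

theorem dual_rpow_ne_zero (hp : 1 < p) (hW : IsApWeight p W Q) (k m : ℤ) :
    (∫⁻ x in dyadicIco k m, W x ^ (-(1 / (p - 1)))) ^ (p - 1) ≠ 0 :=
  (ENNReal.rpow_pos (pos_iff_ne_zero.2 (hW.lintegral_dual_ne_zero k m))
    (hW.lintegral_dual_ne_top hp k m)).ne'

theorem lintegral_ne_top (hp : 1 < p) (hW : IsApWeight p W Q) (k m : ℤ) :
    ∫⁻ x in dyadicIco k m, W x ≠ ∞ := by
  intro h
  refine hW.mul_ne_top hp k m ?_
  rw [h, ENNReal.top_mul (hW.dual_rpow_ne_zero hp k m)]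

/-- Hölder's inequality for a weight and its dual weight. -/
theorem setLIntegral_rpow_le (hp : 1 < p) (hW : IsApWeight p W Q) {g : ℝ → ℝ≥0∞}
    (hg : Measurable g) (F : Set ℝ) :
    (∫⁻ x in F, g x) ^ p ≤
      (∫⁻ x in F, g x ^ p * W x) * (∫⁻ x in F, W x ^ (-(1 / (p - 1)))) ^ (p - 1) := by
  have hp0 : 0 < p := by linarith
  have hp1 : 0 < p - 1 := by linarith
  have hc : p.HolderConjugate (p / (p - 1)) := Real.HolderConjugate.conjExponent hp
  have h := ENNReal.lintegral_mul_le_Lp_mul_Lq (volume.restrict F) hc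
    (f := fun x => g x * W x ^ (1 / p)) (g := fun x => W x ^ (-(1 / p)))
    (hg.mul (hW.measurable.pow_const _)).aemeasurable (hW.measurable.pow_const _).aemeasurable
  have e1 : ∀ x, ((fun x => g x * W x ^ (1 / p)) * fun x => W x ^ (-(1 / p))) x = g x := by
    intro x
    rw [Pi.mul_apply, mul_assoc, ← ENNReal.rpow_add _ _ (hW.ne_zero x) (hW.ne_top x),
      add_neg_cancel, ENNReal.rpow_zero, mul_one]
  have e2 : ∀ x, (g x * W x ^ (1 / p)) ^ p = g x ^ p * W x := by
    intro x
    rw [ENNReal.mul_rpow_of_nonneg _ _ hp0.le, ← ENNReal.rpow_mul, one_div_mul_cancel hp0.ne',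
      ENNReal.rpow_one]
  have e3 : ∀ x, (W x ^ (-(1 / p))) ^ (p / (p - 1)) = W x ^ (-(1 / (p - 1))) := by
    intro x
    rw [← ENNReal.rpow_mul]
    congr 1
    field_simp
  rw [lintegral_congr e1, lintegral_congr e2, lintegral_congr e3] at h
  refine (ENNReal.rpow_le_rpow h hp0.le).trans (le_of_eq ?_)
  rw [ENNReal.mul_rpow_of_nonneg _ _ hp0.le, ← ENNReal.rpow_mul, ← ENNReal.rpow_mul,
    one_div_mul_cancel hp0.ne', ENNReal.rpow_one]
  congr 2
  field_simp

/-- A subset of at most half of a dyadic interval carries at most a fixed proportion of the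
weighted measure. -/
theorem withDensity_le_of_volume_le (hp : 1 < p) (hW : IsApWeight p W Q) {k m : ℤ} {E : Set ℝ}
    (hE : MeasurableSet E) (hEI : E ⊆ dyadicIco k m)
    (hvol : 2 * volume E ≤ volume (dyadicIco k m)) :
    (volume.withDensity W) E ≤
      ((1 - (2 ^ p * Q)⁻¹ : ℝ≥0) : ℝ≥0∞) * (volume.withDensity W) (dyadicIco k m) := by
  have hp0 : 0 < p := by linarith
  set I := dyadicIco k m
  have hIm : MeasurableSet I := measurableSet_dyadicIco k m
  have hsplit : volume (I \ E) + volume E = volume I := by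
    rw [add_comm, measure_add_sdiff hE.nullMeasurableSet, Set.union_eq_self_of_subset_left hEI]
  have hF : volume I ≤ 2 * volume (I \ E) := by
    have h1 : 2 * volume I ≤ 2 * volume (I \ E) + volume I :=
      calc 2 * volume I = 2 * volume (I \ E) + 2 * volume E := by rw [← hsplit, mul_add]
        _ ≤ 2 * volume (I \ E) + volume I := by gcongr
    rw [two_mul (volume I)] at h1
    exact ENNReal.le_of_add_le_add_right (volume_dyadicIco_ne_top k m) h1
  have h1 := hW.setLIntegral_rpow_le hp (g := fun _ => 1) measurable_const (I \ E)
  simp only [lintegral_const, Measure.restrict_apply_univ, one_mul, ENNReal.one_rpow] at h1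
  set S := (∫⁻ x in I, W x ^ (-(1 / (p - 1)))) ^ (p - 1)
  have hS0 : S ≠ 0 := hW.dual_rpow_ne_zero hp k m
  have hS_top : S ≠ ∞ := ENNReal.rpow_ne_top_of_nonneg (by linarith)
    (hW.lintegral_dual_ne_top hp k m)
  -- The complement `I \ E` has at least half the volume. Chaining the `A_p` condition on `I` with
  -- Hölder on `I \ E` and cancelling the dual factor `S` bounds `w(I)` by `2^p Q w(I \ E)`.
  have h2 : (∫⁻ x in I, W x) ≤ (2 ^ p * Q : ℝ≥0) * ∫⁻ x in I \ E, W x := by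
    rw [← ENNReal.mul_le_mul_iff_left hS0 hS_top]
    calc (∫⁻ x in I, W x) * S ≤ Q * volume I ^ p := hW.mul_le k m
      _ ≤ Q * (2 * volume (I \ E)) ^ p := by gcongr
      _ = Q * (2 ^ p * volume (I \ E) ^ p) := by rw [ENNReal.mul_rpow_of_nonneg _ _ hp0.le]
      _ ≤ Q * (2 ^ p * ((∫⁻ x in I \ E, W x) * S)) := by
          gcongr
          refine h1.trans ?_
          exact mul_le_mul_right (ENNReal.rpow_le_rpow (lintegral_mono_set Set.sdiff_subset)
            (by linarith)) _
      _ = (2 ^ p * Q : ℝ≥0) * (∫⁻ x in I \ E, W x) * S := by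
          rw [ENNReal.coe_mul, ENNReal.coe_rpow_of_nonneg _ hp0.le, ENNReal.coe_ofNat]
          ring
  rw [withDensity_apply _ hE, withDensity_apply _ hIm]
  have hs : (∫⁻ x in I, W x) = (∫⁻ x in E, W x) + ∫⁻ x in I \ E, W x := by
    rw [← lintegral_inter_add_sdiff W I hE, Set.inter_eq_right.2 hEI]
  have hfin : (∫⁻ x in I, W x) ≠ ∞ := hW.lintegral_ne_top hp k m
  have hc0 : (2 ^ p * Q : ℝ≥0) ≠ 0 :=
    mul_ne_zero (NNReal.rpow_pos two_pos).ne' (zero_lt_one.trans_le hW.one_le).ne'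
  have h3 : (((2 ^ p * Q)⁻¹ : ℝ≥0) : ℝ≥0∞) * (∫⁻ x in I, W x) ≤ ∫⁻ x in I \ E, W x := by
    refine (mul_le_mul_right h2 _).trans (le_of_eq ?_)
    rw [← mul_assoc, ← ENNReal.coe_mul, inv_mul_cancel₀ hc0, ENNReal.coe_one, one_mul]
  rw [ENNReal.coe_sub, ENNReal.sub_mul fun _ _ => hfin, ENNReal.coe_one, one_mul]
  refine ENNReal.le_sub_of_add_le_right
    (ENNReal.mul_ne_top ENNReal.coe_ne_top hfin) ?_
  calc _ ≤ (∫⁻ x in E, W x) + ∫⁻ x in I \ E, W x := by gcongr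
    _ = _ := hs.symm

theorem one_sub_lt_one (hW : IsApWeight p W Q) : (1 - (2 ^ p * Q)⁻¹ : ℝ≥0) < 1 :=
  tsub_lt_self zero_lt_one (inv_pos.2 (mul_pos (NNReal.rpow_pos two_pos)
    (zero_lt_one.trans_le hW.one_le)))

/-- Muckenhoupt's theorem for the dyadic maximal function. -/
theorem lintegral_dyadicMax_rpow_le (hp : 1 < p) (hW : IsApWeight p W Q) :
    ∃ C : ℝ≥0, ∀ (g : ℝ → ℝ≥0∞), Measurable g → ∀ (K : ℤ) (n : ℕ),
      ∫⁻ x, dyadicMax volume g K n x ^ p ∂(volume.withDensity W) ≤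
        C * ∫⁻ x, g x ^ p ∂(volume.withDensity W) := by
  have hp0 : 0 < p := by linarith
  have hp1 : 0 < p - 1 := by linarith
  set q := p / (p - 1) with hq
  have hq1 : 1 < q := by rw [hq, lt_div_iff₀ hp1]; linarith
  have hq0 : 0 < q := by linarith
  refine ⟨(Q ^ q * Real.toNNReal (2 ^ q * (q / (q - 1)))) *
    Real.toNNReal (2 ^ p * (p / (p - 1))), fun g hg K n => ?_⟩
  -- With `M_μ` the maximal function of `μ`, the proof rests on `(M g)^(p-1) ≤ Q M_w (M_σ
  -- (g/σ)^(p-1) / w)`. Here `g₁ = g/σ`, `A = M_σ g₁` and `g₂ = A^(p-1)/w`; Doob's inequality is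
  -- used for `w dx` with exponent `q` and for `σ dx` with exponent `p`.
  set σ : ℝ → ℝ≥0∞ := fun x => W x ^ (-(1 / (p - 1))) with hσ
  have hσm : Measurable σ := hW.measurable_dual
  set g₁ : ℝ → ℝ≥0∞ := fun x => g x * W x ^ (1 / (p - 1)) with hg₁
  have hg₁m : Measurable g₁ := hg.mul (hW.measurable.pow_const _)
  set A := dyadicMax (volume.withDensity σ) g₁ K n
  have hAm : Measurable A := (dyadicAdapted_max _ _ K n).measurable
  set g₂ : ℝ → ℝ≥0∞ := fun x => A x ^ (p - 1) * (W x)⁻¹ with hg₂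
  have hg₂m : Measurable g₂ := (hAm.pow_const _).mul hW.measurable.inv
  have hpt : ∀ x, dyadicMax volume g K n x ^ p ≤
      (Q : ℝ≥0∞) ^ q * dyadicMax (volume.withDensity W) g₂ K n x ^ q := by
    intro x
    set M := dyadicMax (volume.withDensity W) g₂ K n x
    have h1 : dyadicMax volume g K n x ≤ (Q * M) ^ (1 / (p - 1)) := by
      refine iSup₂_le fun j hj => ?_
      rw [one_div, ENNReal.le_rpow_inv_iff hp1]
      refine le_trans ?_ (mul_le_mul_right (dyadicAvg_le_dyadicMax _ g₂ K hj x) _)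
      rw [dyadicAvg, dyadicAvg]
      set I := dyadicCell (K + j) x
      have hIm : MeasurableSet I := measurableSet_dyadicCell _ _
      have hv0 : volume I ≠ 0 := volume_dyadicIco_ne_zero _ _
      have hvt : volume I ≠ ∞ := volume_dyadicIco_ne_top _ _
      have hu0 : ∫⁻ y in I, W y ≠ 0 := hW.lintegral_ne_zero _ _
      have hut : ∫⁻ y in I, W y ≠ ∞ := hW.lintegral_ne_top hp _ _
      have hs0 : ∫⁻ y in I, σ y ≠ 0 := hW.lintegral_dual_ne_zero _ _
      have hst : ∫⁻ y in I, σ y ≠ ∞ := hW.lintegral_dual_ne_top hp _ _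
      have hAp : (∫⁻ y in I, W y) * (∫⁻ y in I, σ y) ^ (p - 1) ≤ Q * volume I ^ p :=
        hW.mul_le _ _
      rw [withDensity_apply _ hIm]
      have hG : ∫⁻ y in I, g₂ y ∂(volume.withDensity W) = ∫⁻ y in I, A y ^ (p - 1) := by
        rw [setLIntegral_withDensity_eq_setLIntegral_mul _ hW.measurable hg₂m hIm]
        refine lintegral_congr fun y => ?_
        rw [Pi.mul_apply, hg₂, mul_comm, mul_assoc, ENNReal.inv_mul_cancel (hW.ne_zero y)
          (hW.ne_top y), mul_one]
      have hσI : ∫⁻ y in I, g₁ y ∂(volume.withDensity σ) = ∫⁻ y in I, g y := by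
        rw [setLIntegral_withDensity_eq_setLIntegral_mul _ hσm hg₁m hIm]
        refine lintegral_congr fun y => ?_
        rw [Pi.mul_apply, hg₁, hσ, mul_comm, mul_assoc, ← ENNReal.rpow_add _ _ (hW.ne_zero y)
          (hW.ne_top y), add_neg_cancel, ENNReal.rpow_zero, mul_one]
      rw [hG]
      set a := ∫⁻ y in I, g y
      set v := volume I
      set u := ∫⁻ y in I, W y
      set s := ∫⁻ y in I, σ y
      -- Everywhere on `I`, `A` is at least the `σ`-average of `g₁` over `I`, which is `a / s`.
      have hlow : v * (a / s) ^ (p - 1) ≤ ∫⁻ y in I, A y ^ (p - 1) := by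
        rw [mul_comm, ← setLIntegral_const]
        refine setLIntegral_mono' hIm fun y hy => ENNReal.rpow_le_rpow ?_ hp1.le
        refine le_trans (le_of_eq ?_) (dyadicAvg_le_dyadicMax _ g₁ K hj y)
        have hcell : dyadicCell (K + j) y = I := dyadicCell_eq_of_mem hy
        rw [dyadicAvg, hcell, hσI, withDensity_apply _ hIm]
      rw [← mul_div_assoc, ENNReal.le_div_iff_mul_le (Or.inl hu0) (Or.inl hut)]
      refine le_trans ?_ (mul_le_mul_right hlow _)
      have hvp : v ^ p = v * v ^ (p - 1) := by
        nth_rw 2 [← ENNReal.rpow_one v]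
        rw [← ENNReal.rpow_add _ _ hv0 hvt, add_sub_cancel]
      have has : a / s * s = a := ENNReal.div_mul_cancel hs0 hst
      have hvr0 : v ^ (p - 1) ≠ 0 := (ENNReal.rpow_pos (pos_iff_ne_zero.2 hv0) hvt).ne'
      have hvrt : v ^ (p - 1) ≠ ∞ := ENNReal.rpow_ne_top_of_nonneg hp1.le hvt
      calc (a / v) ^ (p - 1) * u = (a / s) ^ (p - 1) * (u * s ^ (p - 1)) / v ^ (p - 1) := by
            rw [ENNReal.div_rpow_of_nonneg a v hp1.le]
            nth_rw 1 [← has]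
            rw [ENNReal.mul_rpow_of_nonneg _ _ hp1.le]
            simp only [div_eq_mul_inv _ (v ^ (p - 1))]
            ring
        _ ≤ (a / s) ^ (p - 1) * (Q * v ^ p) / v ^ (p - 1) := by gcongr
        _ = Q * (v * (a / s) ^ (p - 1)) * (v ^ (p - 1) / v ^ (p - 1)) := by
            rw [hvp]; simp only [div_eq_mul_inv _ (v ^ (p - 1))]; ring
        _ = Q * (v * (a / s) ^ (p - 1)) := by rw [ENNReal.div_self hvr0 hvrt, mul_one]
    calc dyadicMax volume g K n x ^ p ≤ ((Q * M) ^ (1 / (p - 1))) ^ p :=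
          ENNReal.rpow_le_rpow h1 hp0.le
      _ = (Q : ℝ≥0∞) ^ q * M ^ q := by
          rw [← ENNReal.rpow_mul, ← ENNReal.mul_rpow_of_nonneg _ _ hq0.le]
          congr 1
          rw [hq]; ring
  -- Exponents match because `(p - 1) q = p` and `1 - q = -1/(p - 1)`.
  have hswap : ∫⁻ x, g₂ x ^ q ∂(volume.withDensity W) =
      ∫⁻ x, A x ^ p ∂(volume.withDensity σ) := by
    rw [lintegral_withDensity_eq_lintegral_mul _ hW.measurable (hg₂m.pow_const q),
      lintegral_withDensity_eq_lintegral_mul _ hσm (hAm.pow_const p)]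
    refine lintegral_congr fun x => ?_
    rw [Pi.mul_apply, Pi.mul_apply, hg₂, hσ, ENNReal.mul_rpow_of_nonneg _ _ hq0.le,
      ← ENNReal.rpow_mul, ← ENNReal.rpow_neg_one, ← ENNReal.rpow_mul, mul_comm (W x), mul_assoc]
    nth_rw 2 [← ENNReal.rpow_one (W x)]
    rw [← ENNReal.rpow_add _ _ (hW.ne_zero x) (hW.ne_top x), mul_comm]
    congr 2
    · rw [hq]; field_simp; ring
    · rw [hq]; field_simp
  have hback : ∫⁻ x, g₁ x ^ p ∂(volume.withDensity σ) =
      ∫⁻ x, g x ^ p ∂(volume.withDensity W) := by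
    rw [lintegral_withDensity_eq_lintegral_mul _ hW.measurable (hg.pow_const p),
      lintegral_withDensity_eq_lintegral_mul _ hσm (hg₁m.pow_const p)]
    refine lintegral_congr fun x => ?_
    rw [Pi.mul_apply, Pi.mul_apply, hg₁, hσ, ENNReal.mul_rpow_of_nonneg _ _ hp0.le,
      ← ENNReal.rpow_mul, mul_left_comm, ← ENNReal.rpow_add _ _ (hW.ne_zero x) (hW.ne_top x),
      mul_comm]
    congr 1
    nth_rw 2 [← ENNReal.rpow_one (W x)]
    congr 1
    field_simp
    ring
  have hM2 := _root_.lintegral_dyadicMax_rpow_le hq1 (volume.withDensity W) hg₂m K n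
  have hM1 := _root_.lintegral_dyadicMax_rpow_le hp (volume.withDensity σ) hg₁m K n
  calc ∫⁻ x, dyadicMax volume g K n x ^ p ∂(volume.withDensity W)
      ≤ ∫⁻ x, (Q : ℝ≥0∞) ^ q * dyadicMax (volume.withDensity W) g₂ K n x ^ q
          ∂(volume.withDensity W) := lintegral_mono hpt
    _ = (Q : ℝ≥0∞) ^ q * ∫⁻ x, dyadicMax (volume.withDensity W) g₂ K n x ^ q
          ∂(volume.withDensity W) :=
        lintegral_const_mul _ ((dyadicAdapted_max _ _ K n).measurable.pow_const q)
    _ ≤ (Q : ℝ≥0∞) ^ q * (ENNReal.ofReal (2 ^ q * (q / (q - 1))) *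
          (ENNReal.ofReal (2 ^ p * (p / (p - 1))) * ∫⁻ x, g x ^ p ∂(volume.withDensity W))) := by
        gcongr
        refine hM2.trans (mul_le_mul_right ?_ _)
        rw [hswap, ← hback]
        exact hM1
    _ = _ := by
        rw [ENNReal.coe_mul, ENNReal.coe_mul, ENNReal.coe_rpow_of_nonneg _ hq0.le,
          ENNReal.ofReal, ENNReal.ofReal]
        ring

end IsApWeight

/-! ### Greedy counting of jumps along a path. -/

open Classical in
/-- The value of the path `a` at the last of the greedily chosen times: a time is chosen when the
path has moved by more than `lam` since the previous chosen time. -/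
noncomputable def greedyBase (lam : ℝ) (a : ℕ → ℂ) : ℕ → ℂ
  | 0 => a 0
  | k + 1 => if lam < ‖a (k + 1) - greedyBase lam a k‖ then a (k + 1) else greedyBase lam a k

open Classical in
/-- The number of greedily chosen times up to time `k`. -/
noncomputable def greedyCount (lam : ℝ) (a : ℕ → ℂ) : ℕ → ℕ
  | 0 => 0
  | k + 1 => if lam < ‖a (k + 1) - greedyBase lam a k‖ then greedyCount lam a k + 1
      else greedyCount lam a k

section Greedy

variable {lam : ℝ} {a : ℕ → ℂ}

theorem norm_sub_greedyBase_le (hlam : 0 ≤ lam) (k : ℕ) : ‖a k - greedyBase lam a k‖ ≤ lam := by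
  cases k with
  | zero => simpa [greedyBase] using hlam
  | succ k =>
    rw [greedyBase]
    split_ifs with h
    · simpa using hlam
    · exact not_lt.1 h

theorem greedyBase_mem (lam : ℝ) (a : ℕ → ℂ) (k : ℕ) : ∃ j ≤ k, greedyBase lam a k = a j := by
  induction k with
  | zero => exact ⟨0, le_rfl, rfl⟩
  | succ k ih =>
    rw [greedyBase]
    split_ifs with h
    · exact ⟨k + 1, le_rfl, rfl⟩
    · obtain ⟨j, hj, e⟩ := ih
      exact ⟨j, by omega, e⟩

theorem greedyCount_mono (lam : ℝ) (a : ℕ → ℂ) : Monotone (greedyCount lam a) := by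
  refine monotone_nat_of_le_succ fun k => ?_
  rw [greedyCount]
  split_ifs <;> omega

theorem greedyBase_eq_of_greedyCount_eq {i j : ℕ} (hij : i ≤ j)
    (h : greedyCount lam a j = greedyCount lam a i) :
    greedyBase lam a j = greedyBase lam a i := by
  induction j, hij using Nat.le_induction with
  | base => rfl
  | succ j hij ih =>
    have h1 := greedyCount_mono lam a hij
    rw [greedyCount] at h
    rw [greedyBase]
    split_ifs at h ⊢
    · omega
    · exact ih h

/-- Without a greedy time after `i` and up to `j`, both values lie within `lam` of the same base
point, hence within `2 * lam` of each other. -/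
theorem greedyCount_lt (hlam : 0 ≤ lam) {i j : ℕ} (hij : i ≤ j) (h : 2 * lam < ‖a j - a i‖) :
    greedyCount lam a i < greedyCount lam a j := by
  refine lt_of_le_of_ne (greedyCount_mono lam a hij) fun he => ?_
  have hb := greedyBase_eq_of_greedyCount_eq hij he.symm
  have h1 := norm_sub_greedyBase_le (a := a) hlam i
  have h2 := norm_sub_greedyBase_le (a := a) hlam j
  rw [hb] at h2
  have h3 := norm_sub_le (a j - greedyBase lam a i) (a i - greedyBase lam a i)
  rw [sub_sub_sub_cancel_right] at h3
  linarith

open Classical in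
theorem greedyCount_add_card_le (hlam : 0 ≤ lam) {u : ℕ → ℕ} (hu : Monotone u) (M : ℕ) :
    greedyCount lam a (u 0) +
      ((Finset.range M).filter fun k => 2 * lam < ‖a (u (k + 1)) - a (u k)‖).card ≤
      greedyCount lam a (u M) := by
  induction M with
  | zero => simp
  | succ M ih =>
    rw [Finset.range_add_one, Finset.filter_insert]
    have hM : u M ≤ u (M + 1) := hu (Nat.le_succ M)
    have hm := greedyCount_mono lam a hM
    split_ifs with h
    · have := greedyCount_lt hlam hM h
      rw [Finset.card_insert_of_notMem (by simp)]
      omega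
    · omega

theorem greedy_congr {b : ℕ → ℂ} {k : ℕ} (h : ∀ j ≤ k, a j = b j) :
    greedyBase lam a k = greedyBase lam b k ∧ greedyCount lam a k = greedyCount lam b k := by
  induction k with
  | zero => exact ⟨h 0 le_rfl, rfl⟩
  | succ k ih =>
    obtain ⟨h1, h2⟩ := ih fun j hj => h j (by omega)
    simp only [greedyBase, greedyCount, h1, h2, h (k + 1) le_rfl, and_self]

/-- By the polarization identity the right side equals `‖a (k+1) - b_k‖² - ‖a (k+1) - b_{k+1}‖²`,
with `b_k` the base point at time `k`. At a greedy time the second square vanishes and the first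
exceeds `lam²`; otherwise the base point is unchanged and the difference is `0`. The inner product
becomes a martingale difference and the rest telescopes. -/
theorem sq_mul_greedyCount_sub_le (hlam : 0 ≤ lam) (k : ℕ) :
    lam ^ 2 * ((greedyCount lam a (k + 1) : ℝ) - greedyCount lam a k) ≤
      -2 * ((starRingEnd ℂ (greedyBase lam a k)) * (a (k + 1) - a k)).re +
      ((‖a (k + 1)‖ ^ 2 - ‖a (k + 1) - greedyBase lam a (k + 1)‖ ^ 2) -
        (‖a k‖ ^ 2 - ‖a k - greedyBase lam a k‖ ^ 2)) := by
  have e : ∀ z w : ℂ, ‖z - w‖ ^ 2 = ‖z‖ ^ 2 + ‖w‖ ^ 2 - 2 * (starRingEnd ℂ w * z).re := by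
    intro z w
    simp only [Complex.sq_norm, Complex.normSq_apply, Complex.sub_re, Complex.sub_im,
      Complex.mul_re, Complex.conj_re, Complex.conj_im]
    ring
  have h1 := e (a (k + 1)) (greedyBase lam a k)
  have h2 := e (a k) (greedyBase lam a k)
  rw [mul_sub (starRingEnd ℂ _), Complex.sub_re]
  rw [greedyCount, greedyBase]
  split_ifs with h
  · have h3 : lam ^ 2 ≤ ‖a (k + 1) - greedyBase lam a k‖ ^ 2 := by gcongr
    rw [sub_self, norm_zero]
    push_cast
    linarith
  · linarith

end Greedy

/-- `ρ` is the indicator that stopping has not yet occurred, so the sum telescopes up to the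
stopping time. The bound on `φ` is needed one step past the last active time. -/
theorem stopped_sum_le {ρ φ : ℕ → ℝ} {n : ℕ} {H : ℝ} (h01 : ∀ k, ρ k = 0 ∨ ρ k = 1)
    (hanti : Antitone ρ) (hn : φ n ≤ H) (hφ : ∀ k, n ≤ k → ρ k = 1 → φ (k + 1) ≤ H) {L : ℕ}
    (hL : n ≤ L) : ∑ k ∈ Finset.Ico n L, ρ k * (φ (k + 1) - φ k) ≤ H - φ n := by
  induction L, hL using Nat.le_induction with
  | base => simpa using hn
  | succ L hL ih =>
    rcases h01 L with h | h
    · rw [Finset.sum_Ico_succ_top hL, h]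
      simpa using ih
    · have h1 : ∀ k ∈ Finset.Ico n (L + 1), ρ k * (φ (k + 1) - φ k) = φ (k + 1) - φ k := by
        intro k hk
        have hk' := hanti (Nat.lt_succ_iff.1 (Finset.mem_Ico.1 hk).2)
        rcases h01 k with h0 | h0
        · rw [h0, h] at hk'; linarith
        · rw [h0, one_mul]
      rw [Finset.sum_congr rfl h1, Finset.sum_Ico_sub _ (by omega)]
      linarith [hφ L hL h]

/-! ### Variation of a path and its control by jumps. -/

/-- The `r`-variation of a path over the times `s, …, L`. -/
noncomputable def pathVariation (r : ℝ) (a : ℕ → ℂ) (s L : ℕ) : ℝ≥0∞ :=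
  ⨆ (M : ℕ) (u : ℕ → ℕ) (_ : Monotone u ∧ ∀ k, s ≤ u k ∧ u k ≤ L),
    (∑ k ∈ Finset.range M, ‖a (u (k + 1)) - a (u k)‖ₑ ^ r) ^ (1 / r)

section Variation

variable {r : ℝ} {a : ℕ → ℂ}

theorem le_pathVariation {s L : ℕ} (M : ℕ) {u : ℕ → ℕ} (hu : Monotone u)
    (hsL : ∀ k, s ≤ u k ∧ u k ≤ L) :
    (∑ k ∈ Finset.range M, ‖a (u (k + 1)) - a (u k)‖ₑ ^ r) ^ (1 / r) ≤ pathVariation r a s L :=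
  le_iSup_of_le M (le_iSup_of_le u (le_iSup_of_le ⟨hu, hsL⟩ le_rfl))

theorem pathVariation_mono {s L L' : ℕ} (h : L ≤ L') :
    pathVariation r a s L ≤ pathVariation r a s L' :=
  iSup_le fun M => iSup₂_le fun _ hu =>
    le_pathVariation M hu.1 fun k => ⟨(hu.2 k).1, (hu.2 k).2.trans h⟩

theorem pathVariation_congr {b : ℕ → ℂ} {s L : ℕ} (h : ∀ j ≤ L, a j = b j) :
    pathVariation r a s L = pathVariation r b s L := by
  refine iSup_congr fun M => iSup_congr fun u => iSup_congr fun hu => ?_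
  simp only [h _ (hu.2 _).2]

/-- Any time sequence is split at `n` into its truncations `min (u k) n` and `max (u k) n`;
increments add, and Minkowski's inequality in `ℓ^r` applies. The truncations repeat times, which is
why `pathVariation` allows merely monotone sequences. -/
theorem pathVariation_add_le (hr : 1 ≤ r) {s n L : ℕ} (hs : s ≤ n) (hL : n ≤ L) :
    pathVariation r a s L ≤ pathVariation r a s n + pathVariation r a n L := by
  refine iSup_le fun M => iSup₂_le fun u hu => ?_
  obtain ⟨hu, hsL⟩ := hu
  have h1 := le_pathVariation (r := r) (a := a) (s := s) (L := n) M (u := fun k => min (u k) n)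
    (fun i j hij => min_le_min_right _ (hu hij)) fun k => ⟨le_min (hsL k).1 hs, min_le_right _ _⟩
  have h2 := le_pathVariation (r := r) (a := a) (s := n) (L := L) M (u := fun k => max (u k) n)
    (fun i j hij => max_le_max_right _ (hu hij)) fun k => ⟨le_max_right _ _, max_le (hsL k).2 hL⟩
  refine le_trans ?_ (add_le_add h1 h2)
  refine le_trans ?_ (ENNReal.Lp_add_le _ _ _ hr)
  refine ENNReal.rpow_le_rpow (Finset.sum_le_sum fun k _ => ?_) (by positivity)
  refine ENNReal.rpow_le_rpow ?_ (by linarith)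
  have e : ∀ i, a i = a (min i n) + a (max i n) - a n := by
    intro i
    rcases le_total i n with h | h <;> simp [h]
  have e2 : a (u (k + 1)) - a (u k) = (a (min (u (k + 1)) n) - a (min (u k) n)) +
      (a (max (u (k + 1)) n) - a (max (u k) n)) := by
    rw [e (u (k + 1)), e (u k)]; ring
  rw [e2]
  exact enorm_add_le _ _

theorem pathVariation_self (hr : 0 < r) (n : ℕ) : pathVariation r a n n = 0 := by
  refine le_antisymm (iSup_le fun M => iSup₂_le fun u hu => ?_) zero_le
  have h : ∀ k, u k = n := fun k => le_antisymm (hu.2 k).2 (hu.2 k).1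
  simp [h, hr]

/-- A monotone sequence in `{n, n + 1}` moves at most once, so at most one increment is nonzero. -/
theorem pathVariation_succ_self_le (hr : 0 < r) (n : ℕ) :
    pathVariation r a n (n + 1) ≤ ‖a (n + 1) - a n‖ₑ := by
  refine iSup_le fun M => iSup₂_le fun u hu => ?_
  obtain ⟨hu, hsL⟩ := hu
  set t := ‖a (n + 1) - a n‖ₑ
  have hle : ∀ M, ∑ k ∈ Finset.range M, ‖a (u (k + 1)) - a (u k)‖ₑ ^ r ≤
      ((u M - n : ℕ) : ℝ≥0∞) * t ^ r := by
    intro M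
    induction M with
    | zero => simp
    | succ M ih =>
      rw [Finset.sum_range_succ]
      have hm := hu (Nat.le_succ M)
      have h1 := hsL M
      have h2 := hsL (M + 1)
      by_cases he : u (M + 1) = u M
      · rw [he, sub_self, enorm_zero, ENNReal.zero_rpow_of_pos hr, add_zero]
        exact ih
      · have e1 : u M = n := by simp only [Nat.succ_eq_add_one] at hm; omega
        have e2 : u (M + 1) = n + 1 := by simp only [Nat.succ_eq_add_one] at hm; omega
        rw [e1, Nat.sub_self, Nat.cast_zero, zero_mul, nonpos_iff_eq_zero] at ih
        rw [ih, e1, e2, zero_add]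
        simp [t]
  calc _ ≤ (1 * t ^ r) ^ (1 / r) := by
        refine ENNReal.rpow_le_rpow ((hle M).trans (mul_le_mul_left ?_ _)) (by positivity)
        have := (hsL M).2
        exact_mod_cast (by omega : u M - n ≤ 1)
    _ = t := by rw [one_mul, ← ENNReal.rpow_mul, mul_one_div_cancel hr.ne', ENNReal.rpow_one]

open Classical in
/-- The `r`-variation of a bounded path is controlled by its numbers of jumps of dyadic sizes. -/
theorem pathVariation_rpow_le (hr : 0 < r) {n L : ℕ} {D : ℝ} (hD : 0 < D)
    (ha : ∀ k, n ≤ k → k ≤ L → ‖a k‖ ≤ D) :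
    pathVariation r a n L ^ r ≤ ∑' m : ℕ, ENNReal.ofReal (2 * D * (1 / 2) ^ m) ^ r *
      ((greedyCount (D * (1 / 2) ^ (m + 1)) a L - greedyCount (D * (1 / 2) ^ (m + 1)) a n : ℕ) :
        ℝ≥0∞) := by
  rw [← ENNReal.le_rpow_inv_iff hr, ← one_div]
  refine iSup_le fun M => iSup₂_le fun u hu => ENNReal.rpow_le_rpow ?_ (by positivity)
  obtain ⟨hu, hsL⟩ := hu
  have hone : ∀ k, ‖a (u (k + 1)) - a (u k)‖ₑ ^ r ≤
      ∑' m : ℕ, ENNReal.ofReal (2 * D * (1 / 2) ^ m) ^ r *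
        (if 2 * (D * (1 / 2) ^ (m + 1)) < ‖a (u (k + 1)) - a (u k)‖ then 1 else 0) := by
    intro k
    set t := ‖a (u (k + 1)) - a (u k)‖ with ht
    rw [← ofReal_norm, ← ht]
    rcases (norm_nonneg (a (u (k + 1)) - a (u k))).eq_or_lt with h0 | h0
    · rw [← ht] at h0
      rw [← h0, ENNReal.ofReal_zero, ENNReal.zero_rpow_of_pos hr]
      exact zero_le
    · have ht2 : t ≤ 2 * D := by
        have h1 := ha _ (hsL (k + 1)).1 (hsL (k + 1)).2
        have h2 := ha _ (hsL k).1 (hsL k).2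
        have h3 := norm_sub_le (a (u (k + 1))) (a (u k))
        linarith
      -- The scale `m` with `2D 2^(-m-1) < t ≤ 2D 2^(-m)`. The lower bound is twice the greedy
      -- threshold, so the increment is seen by that greedy count.
      obtain ⟨m, hm1, hm2⟩ := exists_nat_pow_near_of_lt_one (x := t / (2 * D)) (y := 1 / 2)
        (by positivity) (by rw [div_le_one (by positivity)]; exact ht2) (by norm_num) (by norm_num)
      rw [lt_div_iff₀ (by positivity)] at hm1
      rw [div_le_iff₀ (by positivity)] at hm2
      refine le_trans ?_ (ENNReal.le_tsum m)
      rw [if_pos (by linarith), mul_one]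
      exact ENNReal.rpow_le_rpow (ENNReal.ofReal_le_ofReal (by linarith)) hr.le
  refine (Finset.sum_le_sum fun k _ => hone k).trans ?_
  rw [← Summable.tsum_finsetSum fun k _ => ENNReal.summable]
  refine ENNReal.tsum_le_tsum fun m => ?_
  rw [← Finset.mul_sum]
  refine mul_le_mul_right ?_ _
  rw [Finset.sum_boole]
  have h1 := greedyCount_add_card_le (lam := D * (1 / 2) ^ (m + 1)) (a := a) (by positivity) hu M
  have h2 := greedyCount_mono (D * (1 / 2) ^ (m + 1)) a (hsL 0).1
  have h3 := greedyCount_mono (D * (1 / 2) ^ (m + 1)) a (hsL M).2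
  exact_mod_cast (by omega)

end Variation

/-! ### From Lebesgue growth to weighted moments. -/

/-- A growth condition with respect to Lebesgue measure gives weighted moment bounds for increasing
adapted processes. -/
theorem IsApWeight.exists_lintegral_rpow_le_of_growth {p : ℝ} {W : ℝ → ℝ≥0∞} {Q : ℝ≥0}
    (hp : 1 < p) (hW : IsApWeight p W Q) {C : ℝ≥0} (hC : 0 < C) (D : ℝ≥0) :
    ∃ A : ℝ≥0, ∀ (g : ℝ → ℝ≥0∞), Measurable g → ∀ (K : ℤ) (L : ℕ) (X : ℕ → ℝ → ℝ≥0∞),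
      (∀ n : ℕ, DyadicAdapted (K + n) (X n)) → (∀ x, X 0 x = 0) →
      (∀ n ≤ L, ∀ x, X n x ≤ X L x) →
      (∀ n x, X (n + 1) x ≤ X n x + D * dyadicMax volume g K (n + 1) x) →
      (∀ n ≤ L, ∀ (m : ℤ) (b : ℝ≥0), 0 < b →
        (∀ x ∈ dyadicIco (K + n) m, dyadicMax volume g K n x ≤ b) →
        2 * volume (dyadicIco (K + n) m ∩ {x | X n x + C * b < X L x}) ≤
          volume (dyadicIco (K + n) m)) →
      ∫⁻ x, X L x ^ p ∂(volume.withDensity W) ≤ A * ∫⁻ x, g x ^ p ∂(volume.withDensity W) := by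
  obtain ⟨A₁, hA₁⟩ := exists_lintegral_rpow_le_of_good_lambda (p := p) (by linarith)
    hW.one_sub_lt_one (C := D + C) (by positivity)
  obtain ⟨A₂, hA₂⟩ := hW.lintegral_dyadicMax_rpow_le hp
  refine ⟨A₁ * A₂, fun g hg K L X hXa hX0 hXm hstep hgrow => ?_⟩
  have hXmeas : Measurable (X L) := (hXa L).measurable
  have hBmeas : Measurable (dyadicMax volume g K L) := (dyadicAdapted_max _ _ K L).measurable
  -- The good-`λ` lemma needs a finite measure, so it is applied on each interval of the initial
  -- generation `K`; the constant does not depend on the interval.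
  have hloc : ∀ m₀, ∫⁻ x in dyadicIco K m₀, X L x ^ p ∂(volume.withDensity W) ≤
      A₁ * ∫⁻ x in dyadicIco K m₀, dyadicMax volume g K L x ^ p ∂(volume.withDensity W) := by
    intro m₀
    have hfin : IsFiniteMeasure ((volume.withDensity W).restrict (dyadicIco K m₀)) := by
      refine isFiniteMeasure_restrict.2 ?_
      rw [withDensity_apply _ (measurableSet_dyadicIco _ _)]
      exact hW.lintegral_ne_top hp K m₀
    refine hA₁ _ (X L) (dyadicMax volume g K L) hXmeas hBmeas fun t b ht hb => ?_
    refine measure_lt_le_of_dyadic_growth hXa (dyadicAdapted_max volume g K) hX0 hXm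
      (fun n hn x => dyadicMax_mono volume g K hn x) hstep ?_ t b hb
    intro n hn m b hb hB
    have hSm : MeasurableSet {x | X n x + C * b < X L x} :=
      measurableSet_lt ((hXa n).measurable.add_const _) hXmeas
    have hIm := measurableSet_dyadicIco (K + n) m
    rw [Measure.restrict_apply (hIm.inter hSm), Measure.restrict_apply hIm]
    rcases dyadicIco_subset_or_disjoint (k := K) (l := K + n) (by omega) m₀ m with h | h
    · rw [Set.inter_eq_left.2 h, Set.inter_eq_left.2 (Set.inter_subset_left.trans h)]
      exact hW.withDensity_le_of_volume_le hp (hIm.inter hSm) Set.inter_subset_left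
        (hgrow n hn m b hb hB)
    · have : dyadicIco (K + n) m ∩ {x | X n x + C * b < X L x} ∩ dyadicIco K m₀ = ∅ :=
        Set.disjoint_iff_inter_eq_empty.1 (h.symm.mono_left Set.inter_subset_left)
      rw [this, measure_empty]
      exact zero_le
  have hglob : ∫⁻ x, X L x ^ p ∂(volume.withDensity W) ≤
      A₁ * ∫⁻ x, dyadicMax volume g K L x ^ p ∂(volume.withDensity W) := by
    have h := measure_le_of_forall_dyadicIco_le
      (μ := (volume.withDensity W).withDensity fun x => X L x ^ p)
      (ν := (volume.withDensity W).withDensity fun x => A₁ * dyadicMax volume g K L x ^ p)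
      (k := K) (E := Set.univ) (fun _ _ _ => by simp) fun m _ => by
        rw [withDensity_apply _ (measurableSet_dyadicIco _ _),
          withDensity_apply _ (measurableSet_dyadicIco _ _),
          lintegral_const_mul _ (hBmeas.pow_const p)]
        exact hloc m
    rwa [withDensity_apply _ MeasurableSet.univ, withDensity_apply _ MeasurableSet.univ,
      Measure.restrict_univ, lintegral_const_mul _ (hBmeas.pow_const p)] at h
  calc _ ≤ _ := hglob
    _ ≤ A₁ * (A₂ * ∫⁻ x, g x ^ p ∂(volume.withDensity W)) := by gcongr; exact hA₂ g hg K L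
    _ = _ := by rw [ENNReal.coe_mul, mul_assoc]

/-! ### The dyadic martingale. -/

/-- The average of `f` over the dyadic interval of length `2⁻ᵏ` around `x`. -/
noncomputable def dyadicExp (f : ℝ → ℂ) (k : ℤ) (x : ℝ) : ℂ :=
  ((2 : ℝ) ^ k) • ∫ y in dyadicCell k x, f y

theorem dyadicAdapted_exp (f : ℝ → ℂ) (k : ℤ) : DyadicAdapted k (dyadicExp f k) :=
  (dyadicAdapted_cell k).comp fun s => ((2 : ℝ) ^ k) • ∫ y in s, f y

theorem inv_volume_dyadicIco (k m : ℤ) :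
    (volume (dyadicIco k m))⁻¹ = ENNReal.ofReal ((2 : ℝ) ^ k) := by
  rw [volume_dyadicIco, ← ENNReal.ofReal_inv_of_pos (by positivity), zpow_neg, inv_inv]

theorem enorm_dyadicExp_le (f : ℝ → ℂ) (k : ℤ) (x : ℝ) :
    ‖dyadicExp f k x‖ₑ ≤ dyadicAvg volume (fun y => ‖f y‖ₑ) k x := by
  have h2 : (0 : ℝ) < 2 ^ k := by positivity
  rw [dyadicExp, dyadicAvg, dyadicCell, div_eq_mul_inv, inv_volume_dyadicIco, enorm_smul, mul_comm,
    Real.enorm_of_nonneg h2.le]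
  gcongr
  exact enorm_integral_le_lintegral_enorm _

/-- Passing to a half divides the volume by two and does not increase the integral. This limits the
overshoot one generation past a stopping time. -/
theorem dyadicAvg_succ_le (g : ℝ → ℝ≥0∞) (k : ℤ) (x : ℝ) :
    dyadicAvg volume g (k + 1) x ≤ 2 * dyadicAvg volume g k x := by
  rw [dyadicAvg, dyadicAvg, div_eq_mul_inv, div_eq_mul_inv, dyadicCell, dyadicCell,
    inv_volume_dyadicIco, inv_volume_dyadicIco, zpow_add₀ two_ne_zero, zpow_one, mul_comm _ (2 : ℝ),
    ENNReal.ofReal_mul zero_le_two, ENNReal.ofReal_ofNat, mul_left_comm]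
  gcongr
  exact dyadicCell_subset (by omega) x

theorem integral_dyadicExp (f : ℝ → ℂ) (k m : ℤ) :
    ∫ x in dyadicIco k m, dyadicExp f k x = ∫ x in dyadicIco k m, f x := by
  have h : Set.EqOn (dyadicExp f k) (fun _ => ((2 : ℝ) ^ k) • ∫ y in dyadicIco k m, f y)
      (dyadicIco k m) := fun x hx => by rw [dyadicExp, dyadicCell_eq_of_mem hx]
  rw [setIntegral_congr_fun (measurableSet_dyadicIco k m) h, setIntegral_const, measureReal_def,
    volume_dyadicIco, ENNReal.toReal_ofReal (by positivity), smul_smul, zpow_neg,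
    inv_mul_cancel₀ (by positivity), one_smul]

theorem integral_dyadicExp_of_le {f : ℝ → ℂ} (hf : ∀ k m, IntegrableOn f (dyadicIco k m))
    {k l : ℤ} (hkl : k ≤ l) (m : ℤ) :
    ∫ x in dyadicIco k m, dyadicExp f l x = ∫ x in dyadicIco k m, f x := by
  have hi : ∀ k m, IntegrableOn (dyadicExp f l) (dyadicIco k m) :=
    (dyadicAdapted_exp f l).integrableOn
  rw [← sub_eq_zero, ← integral_sub (hi k m) (hf k m)]
  refine integral_eq_zero_of_forall_dyadicIco hkl ((hi k m).sub (hf k m)) fun b _ => ?_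
  rw [integral_sub (hi l b) (hf l b), integral_dyadicExp, sub_self]

/-- Martingale differences are orthogonal to functions of the past. -/
theorem integral_mul_dyadicExp_sub {f : ℝ → ℂ} (hf : ∀ k m, IntegrableOn f (dyadicIco k m))
    {k l : ℤ} (hkl : k ≤ l) (m : ℤ) {h : ℝ → ℂ} (hh : DyadicAdapted l h) :
    ∫ x in dyadicIco k m, h x * (dyadicExp f (l + 1) x - dyadicExp f l x) = 0 := by
  have hd : DyadicAdapted (l + 1) fun x => dyadicExp f (l + 1) x - dyadicExp f l x :=
    (dyadicAdapted_exp f (l + 1)).comp₂ (· - ·) ((dyadicAdapted_exp f l).mono (by omega))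
  have hp : DyadicAdapted (l + 1) fun x => h x * (dyadicExp f (l + 1) x - dyadicExp f l x) :=
    (hh.mono (by omega)).comp₂ (· * ·) hd
  refine integral_eq_zero_of_forall_dyadicIco hkl (hp.integrableOn k m) fun b _ => ?_
  obtain ⟨y, hy⟩ := dyadicIco_nonempty l b
  rw [setIntegral_congr_fun (g := fun x => h y * (dyadicExp f (l + 1) x - dyadicExp f l x))
    (measurableSet_dyadicIco l b) fun x hx => by
      change h x * _ = h y * _
      rw [hh.eq_of_mem hx hy], integral_const_mul,
    integral_sub ((dyadicAdapted_exp f (l + 1)).integrableOn l b)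
      ((dyadicAdapted_exp f l).integrableOn l b),
    integral_dyadicExp_of_le hf (by omega), integral_dyadicExp, sub_self, mul_zero]

/-- The path `j ↦ E_{K+j} f(x)` of the dyadic martingale. -/
noncomputable def dyadicPath (f : ℝ → ℂ) (K : ℤ) (x : ℝ) (j : ℕ) : ℂ := dyadicExp f (K + j) x

theorem dyadicPath_eq {f : ℝ → ℂ} {K : ℤ} {n : ℕ} {x y : ℝ}
    (h : dyadicIndex (K + n) x = dyadicIndex (K + n) y) {j : ℕ} (hj : j ≤ n) :
    dyadicPath f K x j = dyadicPath f K y j :=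
  (dyadicAdapted_exp f (K + j)).mono (by omega) x y h

theorem dyadicAdapted_greedyBase (f : ℝ → ℂ) (K : ℤ) (lam : ℝ) (n : ℕ) :
    DyadicAdapted (K + n) fun x => greedyBase lam (dyadicPath f K x) n :=
  fun _ _ h => (greedy_congr fun _ hj => dyadicPath_eq h hj).1

theorem dyadicAdapted_greedyCount (f : ℝ → ℂ) (K : ℤ) (lam : ℝ) (n : ℕ) :
    DyadicAdapted (K + n) fun x => greedyCount lam (dyadicPath f K x) n :=
  fun _ _ h => (greedy_congr fun _ hj => dyadicPath_eq h hj).2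

theorem dyadicAdapted_pathVariation (f : ℝ → ℂ) (K : ℤ) (r : ℝ) (s n : ℕ) :
    DyadicAdapted (K + n) fun x => pathVariation r (dyadicPath f K x) s n :=
  fun _ _ h => pathVariation_congr fun _ hj => dyadicPath_eq h hj

theorem measurable_greedyCount_sub (f : ℝ → ℂ) (K : ℤ) (lam : ℝ) {n L : ℕ} (hnL : n ≤ L) :
    Measurable fun x => ((greedyCount lam (dyadicPath f K x) L -
      greedyCount lam (dyadicPath f K x) n : ℕ) : ℝ≥0∞) :=
  DyadicAdapted.measurable (k := K + L) <| (dyadicAdapted_greedyCount f K lam L).comp₂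
    (fun (i j : ℕ) => ((i - j : ℕ) : ℝ≥0∞)) ((dyadicAdapted_greedyCount f K lam n).mono (by omega))

theorem enorm_dyadicPath_le_dyadicMax (f : ℝ → ℂ) (K : ℤ) {j n : ℕ} (hj : j ≤ n) (x : ℝ) :
    ‖dyadicPath f K x j‖ₑ ≤ dyadicMax volume (fun y => ‖f y‖ₑ) K n x :=
  (enorm_dyadicExp_le f _ x).trans (dyadicAvg_le_dyadicMax _ _ K hj x)

theorem norm_le_of_enorm_le {E : Type*} [SeminormedAddCommGroup E] {z : E} {b : ℝ≥0}
    (h : ‖z‖ₑ ≤ b) : ‖z‖ ≤ b := by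
  rw [enorm_le_coe] at h
  exact_mod_cast h

/-! ### Growth of the jump count beyond a dyadic interval. -/

/-- The set where the averages of `g` over the intervals of lengths `2⁻ᵏ, …, 2⁻⁽ᵏ⁺ⁿ⁾` are at most
`4 b`. -/
def smallAvgSet (g : ℝ → ℝ≥0∞) (k : ℤ) (n : ℕ) (b : ℝ≥0) : Set ℝ :=
  {x | dyadicMax volume g k n x ≤ (4 * b : ℝ≥0)}

theorem measurableSet_smallAvgSet (g : ℝ → ℝ≥0∞) (k : ℤ) (n : ℕ) (b : ℝ≥0) :
    MeasurableSet (smallAvgSet g k n b) :=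
  ((dyadicAdapted_max volume g k n).comp (· ≤ ((4 * b : ℝ≥0) : ℝ≥0∞))).measurableSet

theorem dyadicAvg_le_of_mem_smallAvgSet {g : ℝ → ℝ≥0∞} {K : ℤ} {n L j : ℕ} {b : ℝ≥0} {x : ℝ}
    (hx : x ∈ smallAvgSet g (K + n) (L - n) b) (hn : n ≤ j) (hL : j ≤ L) :
    dyadicAvg volume g (K + j) x ≤ (4 * b : ℝ≥0) := by
  have h := dyadicAvg_le_dyadicMax volume g (K + n) (j := j - n) (n := L - n) (by omega) x
  have e : K + n + ((j - n : ℕ) : ℤ) = K + j := by omega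
  rw [e] at h
  exact h.trans hx

open Classical in
/-- The expected number of greedy jumps after time `n`, on the set where the averages of `f` remain
small. -/
theorem ofReal_mul_lintegral_greedyCount_sub_le {f : ℝ → ℂ}
    (hf : ∀ k m, IntegrableOn f (dyadicIco k m)) {K : ℤ} {n L : ℕ} (hnL : n ≤ L) {m : ℤ} {b : ℝ≥0}
    (hB : ∀ x ∈ dyadicIco (K + n) m, dyadicMax volume (fun y => ‖f y‖ₑ) K n x ≤ b) {lam : ℝ}
    (hlam : 0 ≤ lam) :
    ENNReal.ofReal (lam ^ 2) *
      ∫⁻ x in dyadicIco (K + n) m ∩ smallAvgSet (fun y => ‖f y‖ₑ) (K + n) (L - n) b,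
        ((greedyCount lam (dyadicPath f K x) L - greedyCount lam (dyadicPath f K x) n : ℕ) : ℝ≥0∞) ≤
      ENNReal.ofReal (68 * (b : ℝ) ^ 2) * volume (dyadicIco (K + n) m) := by
  set I := dyadicIco (K + n) m
  have hIm : MeasurableSet I := measurableSet_dyadicIco _ _
  set g : ℝ → ℝ≥0∞ := fun y => ‖f y‖ₑ
  set G := smallAvgSet g (K + n) (L - n) b
  -- Indicator that no average from time `n` to `k` has exceeded `4 b`. It is known at generation `K
  -- + k`, so `F k` is an admissible multiplier of the next martingale difference and `Z` has
  -- integral zero over `I`.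
  set ρ : ℝ → ℕ → ℝ := fun x k =>
    if ∀ j : ℕ, n ≤ j → j ≤ k → dyadicAvg volume g (K + j) x ≤ (4 * b : ℝ≥0) then 1 else 0 with hρ
  have hρa : ∀ k : ℕ, DyadicAdapted (K + k) fun x => ρ x k := by
    intro k x y h
    have : ∀ j : ℕ, j ≤ k → dyadicAvg volume g (K + j) x = dyadicAvg volume g (K + j) y :=
      fun j hj => (dyadicAdapted_avg volume g (K + j)).mono (by omega) x y h
    simp only [hρ]
    congr 1
    refine propext (forall_congr' fun j => forall₂_congr fun _ hj => ?_)
    rw [this j hj]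
  set F : ℕ → ℝ → ℂ := fun k x => (ρ x k : ℂ) *
    (starRingEnd ℂ) (greedyBase lam (dyadicPath f K x) k) with hF
  have hFa : ∀ k : ℕ, DyadicAdapted (K + k) (F k) := fun k =>
    (hρa k).comp₂ (fun (s : ℝ) (z : ℂ) => (s : ℂ) * (starRingEnd ℂ) z)
      (dyadicAdapted_greedyBase f K lam k)
  set Z : ℝ → ℂ := fun x => ∑ k ∈ Finset.Ico n L,
    F k x * (dyadicExp f (K + k + 1) x - dyadicExp f (K + k) x) with hZ
  have hterm : ∀ k : ℕ, IntegrableOn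
      (fun x => F k x * (dyadicExp f (K + k + 1) x - dyadicExp f (K + k) x)) I := by
    intro k
    have hd : DyadicAdapted (K + k + 1)
        fun x => dyadicExp f (K + k + 1) x - dyadicExp f (K + k) x :=
      (dyadicAdapted_exp f _).comp₂ (· - ·) ((dyadicAdapted_exp f _).mono (by omega))
    have h := ((hFa k).mono (l := K + k + 1) (by omega)).comp₂ (· * ·) hd
    exact h.integrableOn _ _
  have hZi : IntegrableOn Z I := integrable_finsetSum _ fun k _ => hterm k
  have hZ0 : ∫ x in I, Z x = 0 := by
    rw [hZ, integral_finsetSum _ fun k _ => hterm k]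
    refine Finset.sum_eq_zero fun k hk => ?_
    have := (Finset.mem_Ico.1 hk).1
    exact integral_mul_dyadicExp_sub hf (by omega) m (hFa k)
  have hpath : ∀ x ∈ I, lam ^ 2 * ∑ k ∈ Finset.Ico n L, ρ x k *
      ((greedyCount lam (dyadicPath f K x) (k + 1) : ℝ) - greedyCount lam (dyadicPath f K x) k) ≤
      -2 * (Z x).re + 68 * (b : ℝ) ^ 2 := by
    intro x hx
    set a := dyadicPath f K x with ha
    set φ : ℕ → ℝ := fun k => ‖a k‖ ^ 2 - ‖a k - greedyBase lam a k‖ ^ 2 with hφ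
    have hb0 : (0 : ℝ) ≤ b := b.2
    have han : ∀ j ≤ n, ‖a j‖ ≤ b := fun j hj => norm_le_of_enorm_le
      ((enorm_dyadicPath_le_dyadicMax f K hj x).trans (hB x hx))
    have h01 : ∀ k, ρ x k = 0 ∨ ρ x k = 1 := by
      intro k
      simp only [hρ]
      split_ifs
      · exact Or.inr rfl
      · exact Or.inl rfl
    have hnn : ∀ k, 0 ≤ ρ x k := fun k => by rcases h01 k with h | h <;> rw [h]; norm_num
    have hanti : Antitone (ρ x) := by
      intro k l hkl
      simp only [hρ]
      split_ifs with h1 h2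
      · exact le_rfl
      · exact absurd (fun j hj hjk => h1 j hj (hjk.trans hkl)) h2
      · exact zero_le_one
      · exact le_rfl
    -- One generation after an average at most `4 b` the path has norm at most `8 b`, whence `64
    -- b²`.
    have hsum_le := stopped_sum_le (ρ := ρ x) (φ := φ) (n := n) (H := 64 * (b : ℝ) ^ 2) h01 hanti
      (by
        have h1 := han n le_rfl
        have h2 := norm_nonneg (a n)
        simp only [hφ]
        nlinarith [sq_nonneg ‖a n - greedyBase lam a n‖])
      (by
        intro k hk h
        have hk4 : dyadicAvg volume g (K + k) x ≤ (4 * b : ℝ≥0) := by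
          by_contra hcon
          simp only [hρ] at h
          rw [if_neg fun h' => hcon (h' k hk le_rfl)] at h
          norm_num at h
        have h1 : ‖a (k + 1)‖ₑ ≤ (8 * b : ℝ≥0) := by
          refine (enorm_dyadicExp_le f _ x).trans ?_
          have e : K + ((k + 1 : ℕ) : ℤ) = K + k + 1 := by push_cast; ring
          rw [e]
          refine (dyadicAvg_succ_le _ _ x).trans ?_
          calc 2 * dyadicAvg volume g (K + k) x ≤ 2 * (4 * b : ℝ≥0) := by gcongr
            _ = (8 * b : ℝ≥0) := by push_cast; ring
        have h2 := norm_le_of_enorm_le h1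
        push_cast at h2
        have h3 := norm_nonneg (a (k + 1))
        simp only [hφ]
        nlinarith [sq_nonneg ‖a (k + 1) - greedyBase lam a (k + 1)‖]) hnL
    -- The base point is an earlier value of the path, so it differs from `a n` by at most `2 b`.
    -- Together with `64 b²` this gives the constant `68`.
    have hφn : -(4 * (b : ℝ) ^ 2) ≤ φ n := by
      obtain ⟨j, hj, e⟩ := greedyBase_mem lam a n
      have h1 := han n le_rfl
      have h2 := han j hj
      have h3 := norm_sub_le (a n) (a j)
      have h4 := norm_nonneg (a n - a j)
      simp only [hφ, e]
      nlinarith [sq_nonneg ‖a n‖]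
    have hsum : lam ^ 2 * ∑ k ∈ Finset.Ico n L, ρ x k *
        ((greedyCount lam a (k + 1) : ℝ) - greedyCount lam a k) ≤
        -2 * (Z x).re + ∑ k ∈ Finset.Ico n L, ρ x k * (φ (k + 1) - φ k) := by
      rw [hZ, Complex.re_sum, Finset.mul_sum, Finset.mul_sum, ← Finset.sum_add_distrib]
      refine Finset.sum_le_sum fun k _ => ?_
      have h := mul_le_mul_of_nonneg_left (sq_mul_greedyCount_sub_le (a := a) hlam k) (hnn k)
      have e : (F k x * (dyadicExp f (K + k + 1) x - dyadicExp f (K + k) x)).re =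
          ρ x k * ((starRingEnd ℂ) (greedyBase lam a k) * (a (k + 1) - a k)).re := by
        rw [hF, mul_assoc, Complex.re_ofReal_mul]
        congr 4
        simp only [ha, dyadicPath]
        push_cast
        rw [add_assoc]
      rw [e]
      simp only [hφ]
      linarith
    linarith
  have hYnn : ∀ x, 0 ≤ lam ^ 2 * ∑ k ∈ Finset.Ico n L, ρ x k *
      ((greedyCount lam (dyadicPath f K x) (k + 1) : ℝ) - greedyCount lam (dyadicPath f K x) k) := by
    intro x
    refine mul_nonneg (sq_nonneg _) (Finset.sum_nonneg fun k _ => mul_nonneg ?_ ?_)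
    · simp only [hρ]; split_ifs <;> norm_num
    · rw [sub_nonneg]; exact_mod_cast greedyCount_mono lam _ (Nat.le_succ k)
  -- On `G` stopping never occurs before `L`, so the stopped sum is the full count.
  have hcount : ∀ x ∈ G, ENNReal.ofReal (lam ^ 2) * ((greedyCount lam (dyadicPath f K x) L -
      greedyCount lam (dyadicPath f K x) n : ℕ) : ℝ≥0∞) = ENNReal.ofReal (lam ^ 2 *
        ∑ k ∈ Finset.Ico n L, ρ x k * ((greedyCount lam (dyadicPath f K x) (k + 1) : ℝ) -
          greedyCount lam (dyadicPath f K x) k)) := by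
    intro x hx
    have h1 : ∀ k ∈ Finset.Ico n L, ρ x k *
        ((greedyCount lam (dyadicPath f K x) (k + 1) : ℝ) - greedyCount lam (dyadicPath f K x) k) =
        (greedyCount lam (dyadicPath f K x) (k + 1) : ℝ) - greedyCount lam (dyadicPath f K x) k := by
      intro k hk
      have hk' := (Finset.mem_Ico.1 hk).2
      simp only [hρ]
      rw [if_pos fun j hj hjk => dyadicAvg_le_of_mem_smallAvgSet hx hj (hjk.trans hk'.le), one_mul]
    rw [Finset.sum_congr rfl h1,
      Finset.sum_Ico_sub (fun k => (greedyCount lam (dyadicPath f K x) k : ℝ)) hnL,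
      ENNReal.ofReal_mul (sq_nonneg _),
      ← Nat.cast_sub (greedyCount_mono lam _ hnL), ENNReal.ofReal_natCast]
  have hNm := measurable_greedyCount_sub f K lam hnL
  have hrei : IntegrableOn (fun x => (Z x).re) I := hZi.re
  have hRi : IntegrableOn (fun x => -2 * (Z x).re + 68 * (b : ℝ) ^ 2) I :=
    (hrei.const_mul (-2)).add (integrableOn_const (volume_dyadicIco_ne_top _ _))
  calc ENNReal.ofReal (lam ^ 2) * ∫⁻ x in I ∩ G, ((greedyCount lam (dyadicPath f K x) L -
        greedyCount lam (dyadicPath f K x) n : ℕ) : ℝ≥0∞)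
      = ∫⁻ x in I ∩ G, ENNReal.ofReal (lam ^ 2) * ((greedyCount lam (dyadicPath f K x) L -
        greedyCount lam (dyadicPath f K x) n : ℕ) : ℝ≥0∞) := (lintegral_const_mul _ hNm).symm
    _ ≤ ∫⁻ x in I ∩ G, ENNReal.ofReal (-2 * (Z x).re + 68 * (b : ℝ) ^ 2) := by
        refine setLIntegral_mono' (hIm.inter (measurableSet_smallAvgSet _ _ _ _)) fun x hx => ?_
        rw [hcount x hx.2]
        exact ENNReal.ofReal_le_ofReal (hpath x hx.1)
    _ ≤ ∫⁻ x in I, ENNReal.ofReal (-2 * (Z x).re + 68 * (b : ℝ) ^ 2) :=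
        lintegral_mono_set Set.inter_subset_left
    _ = ENNReal.ofReal (∫ x in I, (-2 * (Z x).re + 68 * (b : ℝ) ^ 2)) := by
        refine (ofReal_integral_eq_lintegral_ofReal hRi ?_).symm
        refine (ae_restrict_iff' hIm).2 (Filter.Eventually.of_forall fun x hx => ?_)
        exact (hYnn x).trans (hpath x hx)
    _ = ENNReal.ofReal (68 * (b : ℝ) ^ 2) * volume I := by
        have hre : ∫ x in I, (Z x).re = 0 := by
          have h := integral_re hZi
          rw [hZ0] at h
          simpa using h
        rw [integral_add (hrei.const_mul (-2)) (integrableOn_const (volume_dyadicIco_ne_top _ _)),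
          integral_const_mul, hre, mul_zero, zero_add, setIntegral_const, smul_eq_mul,
          measureReal_def,
          ENNReal.ofReal_mul ENNReal.toReal_nonneg,
          ENNReal.ofReal_toReal (volume_dyadicIco_ne_top _ _), mul_comm]

/-- The average of `g` over the interval itself is at most `b`, so the weak type inequality at
height `4 b` gives a quarter. -/
theorem four_mul_volume_sdiff_smallAvgSet_le {g : ℝ → ℝ≥0∞} {K : ℤ} {n : ℕ} (l : ℕ) {m : ℤ}
    {b : ℝ≥0} (hb : 0 < b) (hB : ∀ x ∈ dyadicIco (K + n) m, dyadicMax volume g K n x ≤ b) :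
    4 * volume (dyadicIco (K + n) m \ smallAvgSet g (K + n) l b) ≤
      volume (dyadicIco (K + n) m) := by
  set I := dyadicIco (K + n) m
  have hb0 : (b : ℝ≥0∞) ≠ 0 := ENNReal.coe_ne_zero.2 hb.ne'
  have h1 := mul_measure_lt_dyadicMax_le volume g (K + n) l (dyadicAdapted_mem_dyadicIco (K + n) m)
    ((4 * b : ℝ≥0) : ℝ≥0∞)
  have h2 : ∫⁻ x in I, g x ≤ b * volume I := by
    obtain ⟨x, hx⟩ := dyadicIco_nonempty (K + n) m
    have h := (dyadicAvg_le_dyadicMax volume g K le_rfl x).trans (hB x hx)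
    rwa [dyadicAvg, dyadicCell_eq_of_mem hx, ENNReal.div_le_iff (volume_dyadicIco_ne_zero _ _)
      (volume_dyadicIco_ne_top _ _)] at h
  have e : I \ smallAvgSet g (K + n) l b =
      I ∩ {x | ((4 * b : ℝ≥0) : ℝ≥0∞) < dyadicMax volume g (K + n) l x} := by
    ext x
    simp [smallAvgSet]
  rw [← ENNReal.mul_le_mul_iff_right hb0 ENNReal.coe_ne_top, e]
  refine le_trans (le_of_eq ?_) (h1.trans h2)
  push_cast
  ring

/-- The part of the interval outside the small-average set has at most a quarter of the volume, and
inside it Markov's inequality gives `c ≤ Y` on at most another quarter. -/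
theorem two_mul_volume_le_of_lintegral_le {g : ℝ → ℝ≥0∞} {K : ℤ} {n l : ℕ} {m : ℤ}
    {b : ℝ≥0} (hb : 0 < b) (hB : ∀ x ∈ dyadicIco (K + n) m, dyadicMax volume g K n x ≤ b)
    {Y : ℝ → ℝ≥0∞} (hY : Measurable Y) {c : ℝ≥0∞} (hc0 : c ≠ 0) (hc : c ≠ ∞)
    (h : 4 * ∫⁻ x in dyadicIco (K + n) m ∩ smallAvgSet g (K + n) l b, Y x ≤
      c * volume (dyadicIco (K + n) m)) {S : Set ℝ} (hS : ∀ x ∈ S, c ≤ Y x) :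
    2 * volume (dyadicIco (K + n) m ∩ S) ≤ volume (dyadicIco (K + n) m) := by
  set I := dyadicIco (K + n) m
  set G := smallAvgSet g (K + n) l b
  have h1 : 4 * volume (I ∩ G ∩ {x | c ≤ Y x}) ≤ volume I := by
    rw [← ENNReal.mul_le_mul_iff_right hc0 hc]
    refine le_trans ?_ h
    have := mul_meas_ge_le_lintegral (μ := volume.restrict (I ∩ G)) hY c
    rw [Measure.restrict_apply (measurableSet_le measurable_const hY), Set.inter_comm] at this
    calc c * (4 * volume (I ∩ G ∩ {x | c ≤ Y x})) = 4 * (c * volume (I ∩ G ∩ {x | c ≤ Y x})) := by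
          ring
      _ ≤ _ := by gcongr
  have h2 := four_mul_volume_sdiff_smallAvgSet_le l hb hB
  have hsub : I ∩ S ⊆ (I \ G) ∪ (I ∩ G ∩ {x | c ≤ Y x}) := by
    rintro x ⟨hx, hxS⟩
    by_cases hxG : x ∈ G
    · exact Or.inr ⟨⟨hx, hxG⟩, hS x hxS⟩
    · exact Or.inl ⟨hx, hxG⟩
  have h3 : 2 * (2 * volume (I ∩ S)) ≤ 2 * volume I := by
    calc 2 * (2 * volume (I ∩ S)) = 4 * volume (I ∩ S) := by rw [← mul_assoc]; norm_num
      _ ≤ 4 * (volume (I \ G) + volume (I ∩ G ∩ {x | c ≤ Y x})) := by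
          gcongr; exact (measure_mono hsub).trans (measure_union_le _ _)
      _ ≤ volume I + volume I := by rw [mul_add]; exact add_le_add h2 h1
      _ = 2 * volume I := (two_mul _).symm
  exact (ENNReal.mul_le_mul_iff_right two_ne_zero ENNReal.ofNat_ne_top).1 h3

/-! ### Weighted inequalities for finite dyadic martingales. -/

/-- The weighted jump inequality for finite dyadic martingales. -/
theorem IsApWeight.exists_lintegral_greedyCount_le {p : ℝ} {W : ℝ → ℝ≥0∞} {Q : ℝ≥0}
    (hp : 1 < p) (hW : IsApWeight p W Q) :
    ∃ A : ℝ≥0, ∀ f : ℝ → ℂ, Measurable f → (∀ k m, IntegrableOn f (dyadicIco k m)) →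
      ∀ (lam : ℝ), 0 < lam → ∀ (K : ℤ) (L : ℕ),
      ∫⁻ x, (ENNReal.ofReal lam * (greedyCount lam (dyadicPath f K x) L : ℝ≥0∞) ^ (1 / 2 : ℝ)) ^ p
        ∂(volume.withDensity W) ≤ A * ∫⁻ x, ‖f x‖ₑ ^ p ∂(volume.withDensity W) := by
  -- `17² = 289 ≥ 4 * 68`, where `68` comes from the jump estimate and `4` from the quarter in
  -- Markov's inequality. The step constant is `2` because a new jump adds at most `lam`, which is
  -- below the distance of two path values.
  obtain ⟨A, hA⟩ := hW.exists_lintegral_rpow_le_of_growth hp (C := 17) (by norm_num) 2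
  refine ⟨A, fun f hfm hf lam hlam K L => ?_⟩
  set g : ℝ → ℝ≥0∞ := fun y => ‖f y‖ₑ
  refine hA g hfm.enorm K L
    (fun n x => ENNReal.ofReal lam * (greedyCount lam (dyadicPath f K x) n : ℝ≥0∞) ^ (1 / 2 : ℝ))
    ?_ ?_ ?_ ?_ ?_
  · exact fun n => (dyadicAdapted_greedyCount f K lam n).comp
      fun i : ℕ => ENNReal.ofReal lam * (i : ℝ≥0∞) ^ (1 / 2 : ℝ)
  · intro x
    simp [greedyCount]
  · intro n hn x
    have := greedyCount_mono lam (dyadicPath f K x) hn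
    gcongr
  · intro n x
    set a := dyadicPath f K x
    have hsucc : greedyCount lam a (n + 1) = greedyCount lam a n ∨
        (greedyCount lam a (n + 1) = greedyCount lam a n + 1 ∧
          lam < ‖a (n + 1) - greedyBase lam a n‖) := by
      rw [greedyCount]
      split_ifs with h
      · exact Or.inr ⟨rfl, h⟩
      · exact Or.inl rfl
    rcases hsucc with h | ⟨h, hlt⟩
    · rw [h]; exact le_self_add
    · rw [h]
      obtain ⟨j, hj, e⟩ := greedyBase_mem lam a n
      have hle : ENNReal.ofReal lam ≤ 2 * dyadicMax volume g K (n + 1) x := by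
        calc ENNReal.ofReal lam ≤ ENNReal.ofReal ‖a (n + 1) - greedyBase lam a n‖ :=
              ENNReal.ofReal_le_ofReal hlt.le
          _ ≤ ‖a (n + 1)‖ₑ + ‖a j‖ₑ := by rw [ofReal_norm, e]; exact enorm_sub_le
          _ ≤ dyadicMax volume g K (n + 1) x + dyadicMax volume g K (n + 1) x :=
              add_le_add (enorm_dyadicPath_le_dyadicMax f K le_rfl x)
                (enorm_dyadicPath_le_dyadicMax f K (by omega) x)
          _ = _ := (two_mul _).symm
      calc ENNReal.ofReal lam * ((greedyCount lam a n + 1 : ℕ) : ℝ≥0∞) ^ (1 / 2 : ℝ)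
          ≤ ENNReal.ofReal lam * ((greedyCount lam a n : ℝ≥0∞) ^ (1 / 2 : ℝ) + 1) := by
            gcongr
            rw [Nat.cast_add, Nat.cast_one]
            refine (ENNReal.rpow_add_le_add_rpow _ _ (by norm_num) (by norm_num)).trans ?_
            rw [ENNReal.one_rpow]
        _ = ENNReal.ofReal lam * (greedyCount lam a n : ℝ≥0∞) ^ (1 / 2 : ℝ) +
              ENNReal.ofReal lam := by rw [mul_add, mul_one]
        _ ≤ _ := by gcongr; exact hle
  · intro n hn m b hb hB
    have hcount := ofReal_mul_lintegral_greedyCount_sub_le hf hn hB hlam.le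
    have hYm := measurable_greedyCount_sub f K lam hn
    have hc0 : ENNReal.ofReal (289 * (b : ℝ) ^ 2) ≠ 0 := by
      rw [Ne, ENNReal.ofReal_eq_zero, not_le]
      have : (0 : ℝ) < b := hb
      positivity
    refine two_mul_volume_le_of_lintegral_le (l := L - n) hb hB
      (Y := fun x => ENNReal.ofReal (lam ^ 2) * ((greedyCount lam (dyadicPath f K x) L -
        greedyCount lam (dyadicPath f K x) n : ℕ) : ℝ≥0∞)) (hYm.const_mul _) hc0
      ENNReal.ofReal_ne_top ?_ ?_
    · rw [lintegral_const_mul _ hYm]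
      refine (mul_le_mul_right hcount 4).trans ?_
      rw [← mul_assoc]
      refine mul_le_mul_left ?_ _
      rw [← ENNReal.ofReal_ofNat 4, ← ENNReal.ofReal_mul (by norm_num)]
      exact ENNReal.ofReal_le_ofReal (by nlinarith [sq_nonneg (b : ℝ)])
    · intro x hx
      rw [Set.mem_ofPred_eq] at hx
      by_contra hcon
      rw [not_le] at hcon
      refine absurd hx (not_lt.2 ?_)
      set N := greedyCount lam (dyadicPath f K x) n
      have hadd : greedyCount lam (dyadicPath f K x) L =
          N + (greedyCount lam (dyadicPath f K x) L - N) :=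
        (Nat.add_sub_of_le (greedyCount_mono lam _ hn)).symm
      set N' := greedyCount lam (dyadicPath f K x) L - N
      have hb17 : ENNReal.ofReal (289 * (b : ℝ) ^ 2) = (17 * b : ℝ≥0∞) ^ (2 : ℝ) := by
        have : (289 * (b : ℝ) ^ 2) = (17 * b) ^ 2 := by ring
        rw [this, ENNReal.ofReal_pow (by positivity), ENNReal.ofReal_mul (by norm_num),
          ENNReal.ofReal_coe_nnreal, ENNReal.ofReal_ofNat, ← ENNReal.rpow_natCast]
        norm_num
      have hsq : ENNReal.ofReal (lam ^ 2) * (N' : ℝ≥0∞) =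
          (ENNReal.ofReal lam * (N' : ℝ≥0∞) ^ (1 / 2 : ℝ)) ^ (2 : ℝ) := by
        rw [ENNReal.mul_rpow_of_nonneg _ _ zero_le_two, ← ENNReal.rpow_mul,
          ENNReal.ofReal_pow hlam.le, ← ENNReal.rpow_natCast]
        norm_num
      rw [hsq, hb17, ENNReal.rpow_lt_rpow_iff two_pos] at hcon
      rw [hadd, Nat.cast_add]
      calc ENNReal.ofReal lam * ((N : ℝ≥0∞) + N') ^ (1 / 2 : ℝ)
          ≤ ENNReal.ofReal lam * ((N : ℝ≥0∞) ^ (1 / 2 : ℝ) + (N' : ℝ≥0∞) ^ (1 / 2 : ℝ)) := by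
            gcongr
            exact ENNReal.rpow_add_le_add_rpow _ _ (by norm_num) (by norm_num)
        _ = ENNReal.ofReal lam * (N : ℝ≥0∞) ^ (1 / 2 : ℝ) +
              ENNReal.ofReal lam * (N' : ℝ≥0∞) ^ (1 / 2 : ℝ) := mul_add _ _ _
        _ ≤ _ := by
            exact add_le_add_right hcon.le _

/-- The weighted variation inequality for finite dyadic martingales. -/
theorem IsApWeight.exists_lintegral_pathVariation_le {p : ℝ} {W : ℝ → ℝ≥0∞} {Q : ℝ≥0}
    (hp : 1 < p) (hW : IsApWeight p W Q) {r : ℝ} (hr : 2 < r) :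
    ∃ A : ℝ≥0, ∀ f : ℝ → ℂ, Measurable f → (∀ k m, IntegrableOn f (dyadicIco k m)) →
      ∀ (K : ℤ) (L : ℕ), ∫⁻ x, pathVariation r (dyadicPath f K x) 0 L ^ p
        ∂(volume.withDensity W) ≤ A * ∫⁻ x, ‖f x‖ₑ ^ p ∂(volume.withDensity W) := by
  have hr0 : 0 < r := by linarith
  have hr1 : 1 ≤ r := by linarith
  -- At scale `i`, with threshold `4b 2^(-i-1)`, the weight `(8b 2^(-i))^r` times the jump bound `17
  -- * 4^i` is `17 (8b)^r q^i`. Four times the sum over `i` is `(8b)^r s = (C b)^r`; `r > 2` makes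
  -- `q < 1`.
  set q : ℝ := 2 ^ (2 - r) with hq
  have hq0 : 0 < q := by positivity
  have hq1 : q < 1 := Real.rpow_lt_one_of_one_lt_of_neg (by norm_num) (by linarith)
  set s : ℝ := 68 * (1 - q)⁻¹ with hs
  have hs0 : 0 < s := mul_pos (by norm_num) (inv_pos.2 (sub_pos.2 hq1))
  set C : ℝ≥0 := 8 * Real.toNNReal (s ^ (1 / r)) with hC
  have hCr : (C : ℝ) = 8 * s ^ (1 / r) := by
    rw [hC, NNReal.coe_mul, Real.coe_toNNReal _ (by positivity)]; norm_num
  have hCpos : 0 < C := by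
    rw [← NNReal.coe_lt_coe, hCr, NNReal.coe_zero]; positivity
  obtain ⟨A, hA⟩ := hW.exists_lintegral_rpow_le_of_growth hp hCpos 2
  refine ⟨A, fun f hfm hf K L => ?_⟩
  set g : ℝ → ℝ≥0∞ := fun y => ‖f y‖ₑ
  refine hA g hfm.enorm K L (fun n x => pathVariation r (dyadicPath f K x) 0 n)
    (dyadicAdapted_pathVariation f K r 0) (fun x => pathVariation_self hr0 0)
    (fun n hn x => pathVariation_mono hn) ?_ ?_
  · intro n x
    refine (pathVariation_add_le hr1 (zero_le) (Nat.le_succ n)).trans ?_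
    gcongr
    refine (pathVariation_succ_self_le hr0 n).trans (enorm_sub_le.trans ?_)
    rw [ENNReal.coe_ofNat, two_mul]
    exact add_le_add (enorm_dyadicPath_le_dyadicMax f K le_rfl x)
      (enorm_dyadicPath_le_dyadicMax f K (Nat.le_succ n) x)
  · intro n hn m b hb hB
    have hb' : (0 : ℝ) < b := hb
    set I := dyadicIco (K + n) m
    set G := smallAvgSet g (K + n) (L - n) b
    have hIG : MeasurableSet (I ∩ G) :=
      (measurableSet_dyadicIco _ _).inter (measurableSet_smallAvgSet _ _ _ _)
    have hYm : Measurable fun x => pathVariation r (dyadicPath f K x) n L ^ r :=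
      (dyadicAdapted_pathVariation f K r n L).measurable.pow_const r
    have hc0 : ((C * b : ℝ≥0) : ℝ≥0∞) ^ r ≠ 0 :=
      (ENNReal.rpow_pos (by exact_mod_cast mul_pos hCpos hb) ENNReal.coe_ne_top).ne'
    have hct : ((C * b : ℝ≥0) : ℝ≥0∞) ^ r ≠ ∞ :=
      ENNReal.rpow_ne_top_of_nonneg hr0.le ENNReal.coe_ne_top
    refine two_mul_volume_le_of_lintegral_le (l := L - n) hb hB hYm hc0 hct ?_ ?_
    · set lam : ℕ → ℝ := fun i => 4 * b * (1 / 2) ^ (i + 1) with hlam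
      have hlam0 : ∀ i, 0 < lam i := fun i => by positivity
      have hpt : ∀ x ∈ I ∩ G, pathVariation r (dyadicPath f K x) n L ^ r ≤
          ∑' i : ℕ, ENNReal.ofReal (2 * (4 * b) * (1 / 2) ^ i) ^ r *
            ((greedyCount (lam i) (dyadicPath f K x) L -
              greedyCount (lam i) (dyadicPath f K x) n : ℕ) : ℝ≥0∞) := by
        intro x hx
        refine pathVariation_rpow_le hr0 (by positivity) fun k hk hkL => ?_
        have h := norm_le_of_enorm_le ((enorm_dyadicExp_le f (K + k) x).trans
          (dyadicAvg_le_of_mem_smallAvgSet hx.2 hk hkL))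
        simpa [dyadicPath] using h
      have hterm : ∀ i, ENNReal.ofReal (2 * (4 * b) * (1 / 2) ^ i) ^ r * ∫⁻ x in I ∩ G,
          ((greedyCount (lam i) (dyadicPath f K x) L -
            greedyCount (lam i) (dyadicPath f K x) n : ℕ) : ℝ≥0∞) ≤
          ENNReal.ofReal ((8 * b) ^ r * 17) * volume I * ENNReal.ofReal q ^ i := by
        intro i
        have h := ofReal_mul_lintegral_greedyCount_sub_le hf hn hB (hlam0 i).le
        have hl : ENNReal.ofReal (lam i ^ 2) ≠ 0 := by
          rw [Ne, ENNReal.ofReal_eq_zero, not_le]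
          have := hlam0 i
          positivity
        rw [← ENNReal.mul_le_mul_iff_right hl ENNReal.ofReal_ne_top, mul_left_comm]
        refine (mul_le_mul_right h _).trans (le_of_eq ?_)
        have hreal : (2 * (4 * (b : ℝ)) * (1 / 2) ^ i) ^ r * (68 * (b : ℝ) ^ 2) =
            lam i ^ 2 * ((8 * b) ^ r * 17 * q ^ i) := by
          have e1 : ((1 / 2 : ℝ) ^ i) ^ r = (2 : ℝ) ^ (-(r * i)) := by
            rw [one_div, inv_pow, ← Real.rpow_natCast, Real.inv_rpow (by positivity),
              ← Real.rpow_mul zero_le_two, Real.rpow_neg zero_le_two, mul_comm]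
          have e2 : q ^ i = (2 : ℝ) ^ (2 * i : ℝ) * 2 ^ (-(r * i)) := by
            rw [hq, ← Real.rpow_natCast, ← Real.rpow_mul zero_le_two, ← Real.rpow_add two_pos]
            congr 1
            ring
          have e3 : (2 : ℝ) ^ (2 * i : ℝ) = (2 ^ i) ^ 2 := by
            rw [← pow_mul, mul_comm i, ← Real.rpow_natCast]
            norm_num
          rw [Real.mul_rpow (by positivity) (by positivity), e1, e2, e3, hlam]
          have e4 : (4 * (b : ℝ) * (1 / 2) ^ (i + 1)) ^ 2 * (2 ^ i) ^ 2 = 4 * b ^ 2 := by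
            rw [one_div, inv_pow, pow_succ]
            field_simp
            ring
          have e5 : 2 * (4 * (b : ℝ)) = 8 * b := by ring
          rw [e5]
          linear_combination (-(17 * (8 * (b : ℝ)) ^ r * 2 ^ (-(r * i)))) * e4
        rw [ENNReal.ofReal_rpow_of_nonneg (by positivity) hr0.le, ← mul_assoc,
          ← ENNReal.ofReal_mul (by positivity), hreal, ENNReal.ofReal_mul (by positivity),
          ENNReal.ofReal_mul (by positivity), ENNReal.ofReal_pow hq0.le]
        ring
      have hmeas : ∀ i, Measurable fun x => ENNReal.ofReal (2 * (4 * b) * (1 / 2) ^ i) ^ r *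
          ((greedyCount (lam i) (dyadicPath f K x) L -
            greedyCount (lam i) (dyadicPath f K x) n : ℕ) : ℝ≥0∞) :=
        fun i => (measurable_greedyCount_sub f K (lam i) hn).const_mul _
      calc 4 * ∫⁻ x in I ∩ G, pathVariation r (dyadicPath f K x) n L ^ r
          ≤ 4 * ∫⁻ x in I ∩ G, ∑' i : ℕ, ENNReal.ofReal (2 * (4 * b) * (1 / 2) ^ i) ^ r *
            ((greedyCount (lam i) (dyadicPath f K x) L -
              greedyCount (lam i) (dyadicPath f K x) n : ℕ) : ℝ≥0∞) := by
            gcongr 4 * ?_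
            exact setLIntegral_mono' hIG hpt
        _ = 4 * ∑' i : ℕ, ENNReal.ofReal (2 * (4 * b) * (1 / 2) ^ i) ^ r * ∫⁻ x in I ∩ G,
            ((greedyCount (lam i) (dyadicPath f K x) L -
              greedyCount (lam i) (dyadicPath f K x) n : ℕ) : ℝ≥0∞) := by
            rw [lintegral_tsum fun i => (hmeas i).aemeasurable]
            congr 1
            exact tsum_congr fun i =>
              lintegral_const_mul _ (measurable_greedyCount_sub f K (lam i) hn)
        _ ≤ 4 * ∑' i : ℕ, ENNReal.ofReal ((8 * b) ^ r * 17) * volume I * ENNReal.ofReal q ^ i := by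
            gcongr 4 * ?_
            exact ENNReal.tsum_le_tsum hterm
        _ = ENNReal.ofReal ((8 * b) ^ r * s) * volume I := by
            rw [ENNReal.tsum_mul_left, ENNReal.tsum_geometric, ← ENNReal.ofReal_one,
              ← ENNReal.ofReal_sub _ hq0.le, ← ENNReal.ofReal_inv_of_pos (sub_pos.2 hq1),
              ← ENNReal.ofReal_ofNat 4, hs]
            have e : (8 * (b : ℝ)) ^ r * (68 * (1 - q)⁻¹) =
                4 * ((8 * b) ^ r * 17) * (1 - q)⁻¹ := by ring
            rw [e, ENNReal.ofReal_mul (p := 4 * ((8 * (b : ℝ)) ^ r * 17)) (by positivity),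
              ENNReal.ofReal_mul (p := 4) (by norm_num)]
            ring
        _ = ((C * b : ℝ≥0) : ℝ≥0∞) ^ r * volume I := by
            congr 1
            rw [← ENNReal.ofReal_coe_nnreal, ENNReal.ofReal_rpow_of_nonneg (by positivity) hr0.le,
              NNReal.coe_mul, hCr]
            congr 1
            have e : 8 * s ^ (1 / r) * (b : ℝ) = 8 * b * s ^ (1 / r) := by ring
            rw [e, Real.mul_rpow (x := 8 * (b : ℝ)) (y := s ^ (1 / r)) (by positivity)
              (by positivity),
              ← Real.rpow_mul hs0.le,
              one_div_mul_cancel hr0.ne', Real.rpow_one]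
    · intro x hx
      rw [Set.mem_ofPred_eq] at hx
      refine ENNReal.rpow_le_rpow ?_ hr0.le
      by_contra hcon
      rw [not_le] at hcon
      refine absurd hx (not_lt.2 ((pathVariation_add_le hr1 zero_le hn).trans ?_))
      gcongr
      exact_mod_cast hcon.le

/-! ### Haar differences as martingale differences. -/

theorem mem_dyadicIco_succ_iff {k m : ℤ} {x : ℝ} :
    x ∈ dyadicIco k m ↔ x ∈ dyadicIco (k + 1) (2 * m) ∪ dyadicIco (k + 1) (2 * m + 1) := by
  rw [Set.mem_union, mem_dyadicIco_iff, mem_dyadicIco_iff, mem_dyadicIco_iff,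
    ← dyadicIndex_succ_ediv]
  omega

theorem dyadicIco_eq_union (k m : ℤ) :
    dyadicIco k m = dyadicIco (k + 1) (2 * m) ∪ dyadicIco (k + 1) (2 * m + 1) :=
  Set.ext fun _ => mem_dyadicIco_succ_iff

theorem dyadicHaar_eq_zero {k m : ℤ} {x : ℝ} (hx : x ∉ dyadicIco k m) : dyadicHaar k m x = 0 := by
  rw [mem_dyadicIco_succ_iff, Set.mem_union, not_or] at hx
  rw [dyadicHaar, Set.indicator_of_notMem hx.1, Set.indicator_of_notMem hx.2, sub_zero, mul_zero]

theorem dyadicHaarCoeff_eq {f : ℝ → ℂ} (hf : ∀ k m, IntegrableOn f (dyadicIco k m)) (k m : ℤ) :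
    dyadicHaarCoeff f k m = (Real.sqrt ((2 : ℝ) ^ k) : ℂ) *
      ((∫ x in dyadicIco (k + 1) (2 * m), f x) - ∫ x in dyadicIco (k + 1) (2 * m + 1), f x) := by
  have h : ∀ x, f x * (dyadicHaar k m x : ℂ) = (Real.sqrt ((2 : ℝ) ^ k) : ℂ) *
      ((dyadicIco (k + 1) (2 * m)).indicator f x -
        (dyadicIco (k + 1) (2 * m + 1)).indicator f x) := by
    intro x
    rw [dyadicHaar]
    by_cases h1 : x ∈ dyadicIco (k + 1) (2 * m) <;>
      by_cases h2 : x ∈ dyadicIco (k + 1) (2 * m + 1) <;>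
      simp [h1, h2] <;> ring
  have hm := measurableSet_dyadicIco (k + 1)
  rw [dyadicHaarCoeff, integral_congr_ae (Filter.Eventually.of_forall h), integral_const_mul,
    integral_sub ((integrable_indicator_iff (hm _)).2 (hf _ _))
      ((integrable_indicator_iff (hm _)).2 (hf _ _)), integral_indicator (hm _),
    integral_indicator (hm _)]

/-- On the two halves of the parent interval both sides are `±2^k` times the difference of the
integrals over the halves; one `√(2^k)` comes from the coefficient and one from the Haar function.
-/
theorem dyadicDelta_eq {f : ℝ → ℂ} (hf : ∀ k m, IntegrableOn f (dyadicIco k m)) (k : ℤ) (x : ℝ) :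
    dyadicDelta (k + 1) f x = dyadicExp f (k + 1) x - dyadicExp f k x := by
  set m := dyadicIndex k x
  have hx : x ∈ dyadicIco k m := mem_dyadicIco_iff.2 rfl
  rw [dyadicDelta, add_sub_cancel_right, tsum_eq_single m, dyadicHaarCoeff_eq hf, dyadicExp,
    dyadicExp]
  swap
  · intro m' hm'
    rw [dyadicHaar_eq_zero, Complex.ofReal_zero, mul_zero]
    rw [mem_dyadicIco_iff]
    exact fun h => hm' h.symm
  have hdisj : Disjoint (dyadicIco (k + 1) (2 * m)) (dyadicIco (k + 1) (2 * m + 1)) :=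
    disjoint_dyadicIco (k + 1) (by omega)
  have hsum : ∫ y in dyadicCell k x, f y = (∫ y in dyadicIco (k + 1) (2 * m), f y) +
      ∫ y in dyadicIco (k + 1) (2 * m + 1), f y := by
    rw [dyadicCell_eq_of_mem hx, dyadicIco_eq_union,
      setIntegral_union hdisj (measurableSet_dyadicIco _ _) (hf _ _) (hf _ _)]
  have hsq : ((Real.sqrt ((2 : ℝ) ^ k) : ℝ) : ℂ) * (Real.sqrt ((2 : ℝ) ^ k) : ℂ) = (2 : ℂ) ^ k := by
    rw [← Complex.ofReal_mul, Real.mul_self_sqrt (by positivity)]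
    push_cast
    rfl
  have h2 : (((2 : ℝ) ^ (k + 1) : ℝ) : ℂ) = 2 * (2 : ℂ) ^ k := by
    rw [zpow_add₀ two_ne_zero]; push_cast; ring
  have h2' : (((2 : ℝ) ^ k : ℝ) : ℂ) = (2 : ℂ) ^ k := by push_cast; rfl
  rw [hsum, dyadicHaar, Complex.real_smul, Complex.real_smul, h2, h2']
  rcases mem_dyadicIco_succ_iff.1 hx with h | h
  · rw [dyadicCell_eq_of_mem h, Set.indicator_of_mem h,
      Set.indicator_of_notMem (Set.disjoint_left.1 hdisj h)]
    push_cast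
    linear_combination ((∫ y in dyadicIco (k + 1) (2 * m), f y) -
      ∫ y in dyadicIco (k + 1) (2 * m + 1), f y) * hsq
  · rw [dyadicCell_eq_of_mem h, Set.indicator_of_mem h,
      Set.indicator_of_notMem (Set.disjoint_right.1 hdisj h)]
    push_cast
    linear_combination -((∫ y in dyadicIco (k + 1) (2 * m), f y) -
      ∫ y in dyadicIco (k + 1) (2 * m + 1), f y) * hsq

theorem dyadicIncrement_eq {f : ℝ → ℂ} (hf : ∀ k m, IntegrableOn f (dyadicIco k m)) {a b : ℤ}
    (hab : a ≤ b) (x : ℝ) : dyadicIncrement f a b x = dyadicExp f b x - dyadicExp f a x := by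
  induction b, hab using Int.leInduction with
  | base => simp [dyadicIncrement]
  | succ b hab ih =>
    have e : Finset.Ioc a (b + 1) = insert (b + 1) (Finset.Ioc a b) := by
      ext j
      simp only [Finset.mem_Ioc, Finset.mem_insert]
      omega
    rw [dyadicIncrement] at ih ⊢
    rw [e, Finset.sum_insert (by simp), ih, dyadicDelta_eq hf]
    ring

theorem dyadicHaarCoeff_congr {f g : ℝ → ℂ} (h : f =ᵐ[volume] g) :
    dyadicHaarCoeff f = dyadicHaarCoeff g := by
  funext k m
  exact integral_congr_ae (h.mono fun x hx => by simp only [hx])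

theorem dyadicIncrement_congr {f g : ℝ → ℂ} (h : f =ᵐ[volume] g) :
    dyadicIncrement f = dyadicIncrement g := by
  funext a b x
  simp only [dyadicIncrement, dyadicDelta, dyadicHaarCoeff_congr h]

/-! ### Passage to infinitely many generations. -/

/-- Integer times can be shifted to the natural number times of a path that starts early enough. -/
theorem exists_dyadicPath_times {f : ℝ → ℂ} (hf : ∀ k m, IntegrableOn f (dyadicIco k m)) {M : ℕ}
    {N : Fin (M + 1) → ℤ} (hN : StrictMono N) : ∃ T₀ : ℕ, ∀ T ≥ T₀, ∃ u : ℕ → ℕ, Monotone u ∧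
      (∀ k, u k ≤ 2 * T) ∧ ∀ (k : Fin M) (x : ℝ), dyadicIncrement f (N k.castSucc) (N k.succ) x =
        dyadicPath f (-(T : ℤ)) x (u (k + 1)) - dyadicPath f (-(T : ℤ)) x (u k) := by
  -- A crude bound placing all times in `[-T, T]`, so that shifting by `T` lands in `[0, 2T]`.
  refine ⟨∑ k, (N k).natAbs, fun T hT => ?_⟩
  have hle : ∀ k, (N k).natAbs ≤ T := fun k =>
    (Finset.single_le_sum (f := fun k => (N k).natAbs) (fun _ _ => Nat.zero_le _)
      (Finset.mem_univ k)).trans hT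
  refine ⟨fun k => (N ⟨min k M, by omega⟩ + T).toNat, ?_, ?_, ?_⟩
  · intro i j hij
    refine Int.toNat_le_toNat (add_le_add_left (hN.monotone ?_) _)
    rw [Fin.mk_le_mk]
    exact min_le_min_right _ hij
  · intro k
    have := hle ⟨min k M, by omega⟩
    dsimp only
    omega
  · intro k x
    have h1 : (⟨min (k : ℕ) M, by omega⟩ : Fin (M + 1)) = k.castSucc :=
      Fin.ext (min_eq_left k.2.le)
    have h2 : (⟨min ((k : ℕ) + 1) M, by omega⟩ : Fin (M + 1)) = k.succ :=
      Fin.ext (min_eq_left k.2)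
    have h3 := hle k.castSucc
    have h4 := hle k.succ
    have e : ∀ a : ℤ, a.natAbs ≤ T → -(T : ℤ) + ((a + T).toNat : ℤ) = a := by
      intro a ha
      omega
    rw [dyadicIncrement_eq hf (hN.monotone (Fin.castSucc_le_succ k)), dyadicPath, dyadicPath]
    dsimp only
    rw [h1, h2, e _ h3, e _ h4]

/-- Each choice of times is finite, hence admissible for the path started at `-T` for all large `T`.
-/
theorem dyadicVariation_le_liminf {f : ℝ → ℂ} (hf : ∀ k m, IntegrableOn f (dyadicIco k m)) (r : ℝ)
    (x : ℝ) : dyadicVariation r f x ≤ Filter.liminf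
      (fun T : ℕ => pathVariation r (dyadicPath f (-(T : ℤ)) x) 0 (2 * T)) Filter.atTop := by
  refine iSup_le fun M => iSup₂_le fun N hN => ?_
  obtain ⟨T₀, h⟩ := exists_dyadicPath_times hf hN
  refine Filter.le_liminf_of_le (by isBoundedDefault) ?_
  filter_upwards [Filter.eventually_ge_atTop T₀] with T hT
  obtain ⟨u, hu, huT, hinc⟩ := h T hT
  refine le_trans (le_of_eq ?_) (le_pathVariation M hu fun k => ⟨Nat.zero_le _, huT k⟩)
  rw [Finset.sum_range]
  simp only [hinc]

/-- The greedy count with threshold `lam / 2` registers every displacement exceeding `lam`, which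
accounts for the factor `2`. -/
theorem dyadicJumpCount_le_liminf {f : ℝ → ℂ} (hf : ∀ k m, IntegrableOn f (dyadicIco k m))
    {lam : ℝ} (hlam : 0 < lam) (x : ℝ) :
    ENNReal.ofReal lam * dyadicJumpCount lam f x ^ (1 / 2 : ℝ) ≤ Filter.liminf
      (fun T : ℕ => 2 * (ENNReal.ofReal (lam / 2) *
        (greedyCount (lam / 2) (dyadicPath f (-(T : ℤ)) x) (2 * T) : ℝ≥0∞) ^ (1 / 2 : ℝ)))
      Filter.atTop := by
  set Λ := Filter.liminf (fun T : ℕ => 2 * (ENNReal.ofReal (lam / 2) *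
    (greedyCount (lam / 2) (dyadicPath f (-(T : ℤ)) x) (2 * T) : ℝ≥0∞) ^ (1 / 2 : ℝ)))
    Filter.atTop
  have hl0 : ENNReal.ofReal lam ≠ 0 := by simpa using hlam
  -- Solving for the count moves the square root to the other side, so the supremum can be bounded
  -- term by term.
  have hcount : dyadicJumpCount lam f x ≤ (Λ / ENNReal.ofReal lam) ^ (2 : ℝ) := by
    refine iSup_le fun M => iSup₂_le fun N hN => ?_
    rw [← ENNReal.rpow_inv_le_iff two_pos, ENNReal.le_div_iff_mul_le (Or.inl hl0)
      (Or.inl ENNReal.ofReal_ne_top), mul_comm, ← one_div]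
    obtain ⟨T₀, h⟩ := exists_dyadicPath_times hf hN
    refine Filter.le_liminf_of_le (by isBoundedDefault) ?_
    filter_upwards [Filter.eventually_ge_atTop T₀] with T hT
    obtain ⟨u, hu, huT, hinc⟩ := h T hT
    have hle := greedyCount_add_card_le (lam := lam / 2) (a := dyadicPath f (-(T : ℤ)) x)
      (by positivity) hu M
    have hle' := greedyCount_mono (lam / 2) (dyadicPath f (-(T : ℤ)) x) (huT M)
    have h2 : ENNReal.ofReal lam = 2 * ENNReal.ofReal (lam / 2) := by
      rw [← ENNReal.ofReal_ofNat 2, ← ENNReal.ofReal_mul zero_le_two, mul_div_cancel₀ _ two_ne_zero]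
    rw [h2, mul_assoc]
    gcongr
    refine le_trans (le_of_eq ?_) ((Nat.le_add_left _ _).trans (hle.trans hle'))
    rw [Finset.card_filter, Finset.card_filter, Finset.sum_range]
    simp only [hinc, mul_div_cancel₀ lam (two_ne_zero (α := ℝ))]
  calc ENNReal.ofReal lam * dyadicJumpCount lam f x ^ (1 / 2 : ℝ)
      ≤ ENNReal.ofReal lam * ((Λ / ENNReal.ofReal lam) ^ (2 : ℝ)) ^ (1 / 2 : ℝ) := by gcongr
    _ = Λ := by
        rw [← ENNReal.rpow_mul, mul_one_div_cancel two_ne_zero, ENNReal.rpow_one,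
          ENNReal.mul_div_cancel hl0 ENNReal.ofReal_ne_top]

/-- Fatou's lemma for the measurable `G T`; `H` itself need not be known to be measurable. -/
theorem lintegral_rpow_le_of_le_liminf {μ : Measure ℝ} {p : ℝ} (hp : 0 < p) {H : ℝ → ℝ≥0∞}
    {G : ℕ → ℝ → ℝ≥0∞} (hG : ∀ T, Measurable (G T))
    (hH : ∀ x, H x ≤ Filter.liminf (fun T => G T x) Filter.atTop) {D : ℝ≥0∞}
    (hD : ∀ T, ∫⁻ x, G T x ^ p ∂μ ≤ D) : ∫⁻ x, H x ^ p ∂μ ≤ D := by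
  calc ∫⁻ x, H x ^ p ∂μ
      ≤ ∫⁻ x, Filter.liminf (fun T => G T x ^ p) Filter.atTop ∂μ := by
        refine lintegral_mono fun x => (ENNReal.rpow_le_rpow (hH x) hp.le).trans (le_of_eq ?_)
        exact (ENNReal.orderIsoRpow p hp).liminf_apply
    _ ≤ Filter.liminf (fun T => ∫⁻ x, G T x ^ p ∂μ) Filter.atTop :=
        lintegral_liminf_le fun T => (hG T).pow_const p
    _ ≤ Filter.liminf (fun _ : ℕ => D) Filter.atTop :=
        Filter.liminf_le_liminf (Filter.Eventually.of_forall hD)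
    _ = D := Filter.liminf_const D

/-! ### Reduction to regular weights and functions, and conclusion. -/

/-- A measurable representative of `w`, reset to `1` where it is not positive, changes `w` only on a
null set and makes every power of the weight harmless. -/
theorem IsDyadicAp.exists_isApWeight {p : ℝ} (hp : 1 < p) {w : ℝ → ℝ} (hw : IsDyadicAp p w) :
    ∃ (W : ℝ → ℝ≥0∞) (Q : ℝ≥0), IsApWeight p W Q ∧ weightMeasure w = volume.withDensity W := by
  obtain ⟨hm, hpos, hfin⟩ := hw
  have hp1 : 0 < p - 1 := by linarith
  set w₀ := hm.mk w with hw₀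
  have hm₀ : Measurable w₀ := hm.measurable_mk
  set W : ℝ → ℝ≥0∞ := fun x => if 0 < w₀ x then ENNReal.ofReal (w₀ x) else 1 with hW
  have hWw : (fun x => ENNReal.ofReal (w x)) =ᵐ[volume] W := by
    filter_upwards [hm.ae_eq_mk, hpos] with x hx hx0
    rw [hx] at hx0 ⊢
    simp only [hW, hw₀, if_pos hx0]
  refine ⟨W, max 1 (dyadicApConst p w).toNNReal, ⟨le_max_left _ _, ?_, ?_, ?_, ?_⟩,
    withDensity_congr_ae hWw⟩
  · exact Measurable.ite (measurableSet_lt measurable_const hm₀) hm₀.ennreal_ofReal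
      measurable_const
  · intro x
    simp only [hW]
    split_ifs with h
    · simpa using h
    · exact one_ne_zero
  · intro x
    simp only [hW]
    split_ifs with h
    · exact ENNReal.ofReal_ne_top
    · exact ENNReal.one_ne_top
  · intro k m
    have hle : (⨍⁻ x in dyadicIco k m, ENNReal.ofReal (w x) ∂volume) *
        (⨍⁻ x in dyadicIco k m, ENNReal.ofReal (w x) ^ (-(1 / (p - 1))) ∂volume) ^ (p - 1) ≤
        dyadicApConst p w :=
      le_iSup₂ (f := fun k m => (⨍⁻ x in dyadicIco k m, ENNReal.ofReal (w x) ∂volume) *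
        (⨍⁻ x in dyadicIco k m, ENNReal.ofReal (w x) ^ (-(1 / (p - 1))) ∂volume) ^ (p - 1)) k m
    have hr : ∀ᵐ x ∂(volume.restrict (dyadicIco k m)), ENNReal.ofReal (w x) = W x :=
      ae_restrict_of_ae hWw
    have hr' : ∀ᵐ x ∂(volume.restrict (dyadicIco k m)),
        ENNReal.ofReal (w x) ^ (-(1 / (p - 1))) = W x ^ (-(1 / (p - 1))) :=
      hr.mono fun x hx => by rw [hx]
    rw [setLAverage_eq, setLAverage_eq, lintegral_congr_ae hr, lintegral_congr_ae hr'] at hle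
    set v := volume (dyadicIco k m)
    have hv0 : v ≠ 0 := volume_dyadicIco_ne_zero k m
    have hvt : v ≠ ∞ := volume_dyadicIco_ne_top k m
    have hvp : v ^ p = v * v ^ (p - 1) := by
      nth_rw 2 [← ENNReal.rpow_one v]
      rw [← ENNReal.rpow_add _ _ hv0 hvt, add_sub_cancel]
    set A := ∫⁻ x in dyadicIco k m, W x
    set S := ∫⁻ x in dyadicIco k m, W x ^ (-(1 / (p - 1)))
    calc A * S ^ (p - 1) = (A / v * v) * ((S / v) ^ (p - 1) * v ^ (p - 1)) := by
          rw [ENNReal.div_mul_cancel hv0 hvt, ← ENNReal.mul_rpow_of_nonneg _ _ hp1.le,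
            ENNReal.div_mul_cancel hv0 hvt]
      _ = (A / v * (S / v) ^ (p - 1)) * v ^ p := by rw [hvp]; ring
      _ ≤ dyadicApConst p w * v ^ p := by gcongr
      _ = ((dyadicApConst p w).toNNReal : ℝ≥0∞) * v ^ p := by
          rw [ENNReal.coe_toNNReal hfin.ne]
      _ ≤ _ := by
          gcongr
          exact le_max_right _ _

/-- Hölder's inequality with the dual weight, whose integral over a dyadic interval is finite. -/
theorem IsApWeight.integrableOn {p : ℝ} (hp : 1 < p) {W : ℝ → ℝ≥0∞} {Q : ℝ≥0}
    (hW : IsApWeight p W Q) {f : ℝ → ℂ} (hf : Measurable f)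
    (hfin : ∫⁻ x, ‖f x‖ₑ ^ p ∂(volume.withDensity W) ≠ ∞) (k m : ℤ) :
    IntegrableOn f (dyadicIco k m) := by
  have hp0 : 0 < p := by linarith
  refine ⟨hf.aestronglyMeasurable, ?_⟩
  have h := hW.setLIntegral_rpow_le hp hf.enorm (dyadicIco k m)
  have h1 : ∫⁻ x in dyadicIco k m, ‖f x‖ₑ ^ p * W x ≠ ∞ := by
    refine ne_top_of_le_ne_top hfin ?_
    rw [lintegral_withDensity_eq_lintegral_mul _ hW.measurable (hf.enorm.pow_const p)]
    refine (setLIntegral_le_lintegral _ _).trans (lintegral_mono fun x => ?_)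
    rw [Pi.mul_apply, mul_comm]
  have h2 := ne_top_of_le_ne_top (ENNReal.mul_ne_top h1 (ENNReal.rpow_ne_top_of_nonneg
    (by linarith : 0 ≤ p - 1) (hW.lintegral_dual_ne_top hp k m))) h
  rw [hasFiniteIntegral_iff_enorm, lt_top_iff_ne_top]
  intro htop
  rw [htop] at h2
  exact h2 (ENNReal.top_rpow_of_pos hp0)

/-- A moment bound for measurable locally integrable functions gives a norm bound for all
functions. -/
theorem IsApWeight.eLpNorm_le {p : ℝ} (hp : 1 < p) {W : ℝ → ℝ≥0∞} {Q : ℝ≥0}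
    (hW : IsApWeight p W Q) {H : (ℝ → ℂ) → ℝ → ℝ≥0∞} {A : ℝ≥0}
    (hcongr : ∀ f g : ℝ → ℂ, f =ᵐ[volume] g → H f = H g)
    (hH : ∀ f : ℝ → ℂ, Measurable f → (∀ k m, IntegrableOn f (dyadicIco k m)) →
      ∫⁻ x, H f x ^ p ∂(volume.withDensity W) ≤ A * ∫⁻ x, ‖f x‖ₑ ^ p ∂(volume.withDensity W))
    {f : ℝ → ℂ} (hf : AEStronglyMeasurable f volume) :
    eLpNorm (H f) (ENNReal.ofReal p) (volume.withDensity W) ≤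
      (A ^ (1 / p) + 1 : ℝ≥0) * eLpNorm f (ENNReal.ofReal p) (volume.withDensity W) := by
  have hp0 : 0 < p := by linarith
  have hac : (volume.withDensity W) ≪ volume := withDensity_absolutelyContinuous _ _
  rw [eLpNorm_congr_ae (hac.ae_le hf.ae_eq_mk), hcongr f _ hf.ae_eq_mk]
  set g := hf.mk f
  have hg : Measurable g := hf.stronglyMeasurable_mk.measurable
  have hp' : ENNReal.ofReal p ≠ 0 := by simpa using hp0
  rw [eLpNorm_eq_lintegral_rpow_enorm_toReal hp' ENNReal.ofReal_ne_top,
    eLpNorm_eq_lintegral_rpow_enorm_toReal hp' ENNReal.ofReal_ne_top, ENNReal.toReal_ofReal hp0.le]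
  simp only [enorm_eq_self]
  by_cases hfin : ∫⁻ x, ‖g x‖ₑ ^ p ∂(volume.withDensity W) = ∞
  -- The summand `1` in the constant keeps it nonzero, so the right side is `∞` here even if `A =
  -- 0`.
  · rw [hfin, ENNReal.top_rpow_of_pos (by positivity), ENNReal.mul_top]
    · exact le_top
    · exact ENNReal.coe_ne_zero.2 (by positivity)
  · calc (∫⁻ x, H g x ^ p ∂(volume.withDensity W)) ^ (1 / p)
        ≤ (A * ∫⁻ x, ‖g x‖ₑ ^ p ∂(volume.withDensity W)) ^ (1 / p) :=
          ENNReal.rpow_le_rpow (hH g hg (hW.integrableOn hp hg hfin)) (by positivity)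
      _ = (A ^ (1 / p) : ℝ≥0) * (∫⁻ x, ‖g x‖ₑ ^ p ∂(volume.withDensity W)) ^ (1 / p) := by
          rw [ENNReal.mul_rpow_of_nonneg _ _ (by positivity),
            ENNReal.coe_rpow_of_nonneg _ (by positivity)]
      _ ≤ _ := by
          gcongr
          exact le_self_add

theorem mainTheorem5 (p : ℝ) (hp : 1 < p) (w : ℝ → ℝ) (hw : IsDyadicAp p w) :
    (∀ r : ℝ, 2 < r → ∃ C : ℝ≥0, ∀ f : ℝ → ℂ, AEStronglyMeasurable f volume →
      eLpNorm (dyadicVariation r f) (ENNReal.ofReal p) (weightMeasure w) ≤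
        C * eLpNorm f (ENNReal.ofReal p) (weightMeasure w)) ∧
    (∃ C : ℝ≥0, ∀ f : ℝ → ℂ, AEStronglyMeasurable f volume → ∀ lam : ℝ, 0 < lam →
      eLpNorm (fun x => ENNReal.ofReal lam * dyadicJumpCount lam f x ^ (1 / 2 : ℝ))
          (ENNReal.ofReal p) (weightMeasure w) ≤
        C * eLpNorm f (ENNReal.ofReal p) (weightMeasure w)) := by
  have hp0 : 0 < p := by linarith
  obtain ⟨W, Q, hW, hwW⟩ := hw.exists_isApWeight hp
  rw [hwW]
  refine ⟨fun r hr => ?_, ?_⟩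
  · obtain ⟨A, hA⟩ := hW.exists_lintegral_pathVariation_le hp hr
    refine ⟨A ^ (1 / p) + 1, fun f hf => hW.eLpNorm_le hp (H := dyadicVariation r) ?_ ?_ hf⟩
    · intro f g h
      funext x
      simp only [dyadicVariation, dyadicIncrement_congr h]
    · intro f hfm hfi
      exact lintegral_rpow_le_of_le_liminf hp0
        (fun T => (dyadicAdapted_pathVariation f (-(T : ℤ)) r 0 (2 * T)).measurable)
        (dyadicVariation_le_liminf hfi r) fun T => hA f hfm hfi _ _
  · obtain ⟨A, hA⟩ := hW.exists_lintegral_greedyCount_le hp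
    -- The factor `2 ^ p` pays for halving the threshold in the greedy count.
    refine ⟨(2 ^ p * A) ^ (1 / p) + 1, fun f hf lam hlam => hW.eLpNorm_le hp
      (H := fun f x => ENNReal.ofReal lam * dyadicJumpCount lam f x ^ (1 / 2 : ℝ)) ?_ ?_ hf⟩
    · intro f g h
      funext x
      simp only [dyadicJumpCount, dyadicIncrement_congr h]
    · intro f hfm hfi
      have hm : ∀ T : ℕ, Measurable fun x => ENNReal.ofReal (lam / 2) *
          (greedyCount (lam / 2) (dyadicPath f (-(T : ℤ)) x) (2 * T) : ℝ≥0∞) ^ (1 / 2 : ℝ) :=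
        fun T => ((dyadicAdapted_greedyCount f (-(T : ℤ)) (lam / 2) (2 * T)).comp
          fun i : ℕ => ENNReal.ofReal (lam / 2) * (i : ℝ≥0∞) ^ (1 / 2 : ℝ)).measurable
      refine lintegral_rpow_le_of_le_liminf hp0 (fun T => (hm T).const_mul 2)
        (dyadicJumpCount_le_liminf hfi hlam) fun T => ?_
      simp only [ENNReal.mul_rpow_of_nonneg 2 _ hp0.le]
      rw [lintegral_const_mul _ ((hm T).pow_const p), ENNReal.coe_mul,
        ENNReal.coe_rpow_of_nonneg _ hp0.le, ENNReal.coe_ofNat, mul_assoc]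
      gcongr
      exact hA f hfm hfi _ (half_pos hlam) _ _
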